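/- **Setting.** Let $n\ge 1$, $f_1,\dots,f_n:\mathbb R^d\to\mathbb R$, $\lambda>0$, and for $x=(x_1,\dots,x_n)\in(\mathbb R^d)^n$ with $\bar x=\frac1n\sum_i x_i$ let $$F(x)=\frac1n\sum_{i=1}^n f_i(x_i)+\frac{\lambda}{2n}\sum_{i=1}^n\|x_i-\bar x\|^2 .$$ Suppose that each $f_i$ is $L_1$-smooth (differentiable with $L_1$-Lipschitz gradient) and $\mu$-strongly convex, i.e. $f_i(y)\ge f_i(x)+\langle\nabla f_i(x),y-x\rangle+\frac\mu2\|y-x\|^2$, where $0<\mu\le L_1$ and $\mu\le\lambda$. **Algorithm (IAPGD + AGD).** Start from $y^0=x^0$. At iteration $k=0,1,2,\dots$ the server computes $\bar y^k=\frac1n\sum_i y_i^k$ (one communication). Each client $i$ runs $\lceil T_k\rceil$ steps of Nesterov's accelerated gradient descent from the starting point $y_i^k$ on the function $h_i^{k+1}(z)=f_i(z)+\frac\lambda2\|z-\bar y^k\|^2$, that is, $u^0=v^0=y_i^k$ and, with $L=L_1+\lambda$, $\kappa=\frac{L_1+\lambda}{\mu+\lambda}$, $$u^{t+1}=v^t-\tfrac1L\nabla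 h_i^{k+1}(v^t),\qquad v^{t+1}=u^{t+1}+\tfrac{\sqrt\kappa-1}{\sqrt\kappa+1}(u^{t+1}-u^t),$$ (one local gradient per step); it sets $x_i^{k+1}=u^{\lceil T_k\rceil}$ and $y_i^{k+1}=x_i^{k+1}+\frac{\sqrt\lambda-\sqrt\mu}{\sqrt\lambda+\sqrt\mu}(x_i^{k+1}-x_i^k)$. Here $$T_k=\sqrt{\frac{L_1+\lambda}{\mu+\lambda}}\,\log\!\left(\frac{1152\,L_1\lambda n^2\left(2\sqrt{\lambda/\mu}+1\right)^2}{\mu^{2}}\right)+4\sqrt{\frac{\mu(L_1+\lambda)}{\lambda(\mu+\lambda)}}\;k .$$ **Theorem.** $F$ attains its minimum $F^\star$, and the following hold. 1. If $\lambda\ge 3\mu$, then for all $k\ge0$ $$F(x^k)-F^\star\le 8\left(1-\sqrt{\mu/\lambda}\right)^k\left(F(x^0)-F^\star\right).$$ 2. There is an absolute constant $C>0$ (independent of $n,d,f_i,L_1,\mu,\lambda,x^0$) such that whenever $F(x^0)-F^\star\le M$ and $0<\varepsilon\le M/2$, there is a number of iterations $K$ with $F(x^k)-F^\star\le\varepsilon$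 for all $k\ge K$, such that the first $K$ iterations use at most $$C\sqrt{\frac\lambda\mu}\,\log\frac M\varepsilon$$ communications, and at most $$C\sqrt{\frac{L_1+\lambda}{\mu}}\;\log\frac M\varepsilon\left(\log\frac{L_1\lambda n}{\mu^2}+\log\frac M\varepsilon\right)=\tilde{\mathcal O}\!\left(\sqrt{\frac{L_1+\lambda}{\mu}}\right)$$ local gradient evaluations per client. -/

import Mathlib

/-- `f` is `L`-smooth: differentiable with `L`-Lipschitz gradient. -/
def IsSmoothWith {d : ℕ} (L : ℝ) (f : EuclideanSpace ℝ (Fin d) → ℝ) : Prop :=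
  Differentiable ℝ f ∧ ∀ x y, ‖gradient f x - gradient f y‖ ≤ L * ‖x - y‖

/-- The first-order inequality defining `μ`-strong convexity of a differentiable function. -/
def IsStronglyConvexWith {d : ℕ} (μ : ℝ) (f : EuclideanSpace ℝ (Fin d) → ℝ) : Prop :=
  ∀ x y, f x + inner ℝ (gradient f x) (y - x) + μ / 2 * ‖y - x‖ ^ 2 ≤ f y

/-- The average `(1/n) ∑ i, x i` of the local models. -/
noncomputable def clientMean {n d : ℕ} (x : Fin n → EuclideanSpace ℝ (Fin d)) :
    EuclideanSpace ℝ (Fin d) :=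
  (1 / (n : ℝ)) • ∑ i, x i

/-- The personalized objective
`F(x) = (1/n) ∑ i, f i (x i) + lam * (1/(2n)) ∑ i, ‖x i - mean x‖²`. -/
noncomputable def fedObjective {n d : ℕ} (f : Fin n → EuclideanSpace ℝ (Fin d) → ℝ) (lam : ℝ)
    (x : Fin n → EuclideanSpace ℝ (Fin d)) : ℝ :=
  1 / (n : ℝ) * ∑ i, f i (x i) +
    lam * (1 / (2 * (n : ℝ)) * ∑ i, ‖x i - clientMean x‖ ^ 2)

/-- The local prox objective `h(z) = g(z) + (lam/2) ‖z - w‖²`. -/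
noncomputable def proxObjective {d : ℕ} (g : EuclideanSpace ℝ (Fin d) → ℝ) (lam : ℝ)
    (w z : EuclideanSpace ℝ (Fin d)) : ℝ :=
  g z + lam / 2 * ‖z - w‖ ^ 2

/-- State of accelerated gradient descent: the iterate, the extrapolated point at which the next
gradient is taken, and the number of gradients evaluated so far. -/
structure AGDState (d : ℕ) where
  iter : EuclideanSpace ℝ (Fin d)
  extra : EuclideanSpace ℝ (Fin d)
  grads : ℕ

/-- One step of Nesterov's accelerated gradient descent for an `L`-smooth, `m`-strongly convex
function `h`: step size `1/L`, momentum `(√(L/m) - 1)/(√(L/m) + 1)`, one gradient evaluation. -/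
noncomputable def agdStep {d : ℕ} (h : EuclideanSpace ℝ (Fin d) → ℝ) (L m : ℝ)
    (s : AGDState d) : AGDState d :=
  let u := s.extra - (1 / L) • gradient h s.extra
  { iter := u
    extra := u + ((√(L / m) - 1) / (√(L / m) + 1)) • (u - s.iter)
    grads := s.grads + 1 }

/-- `T` steps of accelerated gradient descent started from `z`. -/
noncomputable def agdRun {d : ℕ} (h : EuclideanSpace ℝ (Fin d) → ℝ) (L m : ℝ)
    (z : EuclideanSpace ℝ (Fin d)) (T : ℕ) : AGDState d :=
  (agdStep h L m)^[T] { iter := z, extra := z, grads := 0 }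

/-- The (real) number `T_k` of inner steps prescribed at outer iteration `k`. -/
noncomputable def innerSteps (n : ℕ) (L₁ μ lam : ℝ) (k : ℕ) : ℝ :=
  √((L₁ + lam) / (μ + lam)) *
      Real.log (1152 * L₁ * lam * (n : ℝ) ^ 2 * (2 * √(lam / μ) + 1) ^ 2 / μ ^ 2) +
    4 * √(μ * (L₁ + lam) / (lam * (μ + lam))) * (k : ℝ)

/-- State of the distributed method: the iterates `x i`, the extrapolated points `y i`, the number
of communication rounds, and the number of local gradients evaluated by each client. -/
structure FedState (n d : ℕ) where
  x : Fin n → EuclideanSpace ℝ (Fin d)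
  y : Fin n → EuclideanSpace ℝ (Fin d)
  comms : ℕ
  grads : Fin n → ℕ

/-- Outer iteration `k` of inexact accelerated proximal gradient descent with AGD as local solver:
the server averages the `y i` (one communication round); client `i` runs `⌈T_k⌉` steps of AGD from
`y i` on its prox subproblem, which is `(L₁ + lam)`-smooth and `(μ + lam)`-strongly convex (one
gradient of `f i` per step), and then takes the momentum step. -/
noncomputable def iapgdStep {n d : ℕ} (f : Fin n → EuclideanSpace ℝ (Fin d) → ℝ)
    (L₁ μ lam : ℝ) (k : ℕ) (s : FedState n d) : FedState n d :=
  let ybar := clientMean s.y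
  let loc : Fin n → AGDState d := fun i =>
    agdRun (proxObjective (f i) lam ybar) (L₁ + lam) (μ + lam) (s.y i)
      ⌈innerSteps n L₁ μ lam k⌉₊
  { x := fun i => (loc i).iter
    y := fun i => (loc i).iter + ((√lam - √μ) / (√lam + √μ)) • ((loc i).iter - s.x i)
    comms := s.comms + 1
    grads := fun i => s.grads i + (loc i).grads }

/-- The state of the method after `k` outer iterations, started from `y⁰ = x⁰`. -/
noncomputable def iapgd {n d : ℕ} (f : Fin n → EuclideanSpace ℝ (Fin d) → ℝ)
    (L₁ μ lam : ℝ) (x₀ : Fin n → EuclideanSpace ℝ (Fin d)) : ℕ → FedState n d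
  | 0 => { x := x₀, y := x₀, comms := 0, grads := fun _ => 0 }
  | k + 1 => iapgdStep f L₁ μ lam k (iapgd f L₁ μ lam x₀ k)

/-! On the product of the client spaces, `n * F` is `f x + (lam/2) ‖x - P x‖²` with `f` separable
and `P` the orthogonal projection onto consensus. A gradient step of length `1/lam` on the penalty
sends `y` to `P y`, so a proximal gradient step minimizes `f + (lam/2) ‖· - P y‖²`: one averaging,
then independent client problems. The method is therefore inexact accelerated proximal gradient with
`s = √(μ/lam)`.

Strong convexity sits in the proximal part `f` rather than in the smooth penalty, so the Lyapunov
function `V = F x - F xs + (μ/2) ‖z - xs‖² - (μ/4) ‖x - xs‖²` (with `F` now the composite objective)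
carries a negative correction. `accelerated_prox_step` reduces its contraction by `ρ` to the sign of
a quadratic form on the range of `P` (`lyapunov_form_nonpos`). That sign holds for `ρ = 1 - s` if `s
≤ 3/5`, which gives the linear rate, and for `ρ = 1 - s/2` for every `s ≤ 1`, which suffices for the
complexity bounds.

The inner error is relative to `V`: AGD starts at `y`, and `‖y - p‖² ≤ 16 V / μ` for the exact step
`p`, so the prescribed local steps leave an error of at most `(s r / 12)² V` with `r = (1 +
2s)^(-k)`. Round `k` then loses a factor `exp (3/5 * s * r)`. The sum of `s * r` over all rounds is
at most `(1 + 2s)/2 ≤ 3/2`, so the total loss is at most `exp (9/10) ≤ 8/3`. The decay of `r` is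
paid for by the linear growth of `T_k`, which adds only a logarithm because `s * k` is of order `log
(M/ε)`. -/

/-- The descent lemma: a function with `L`-Lipschitz gradient lies below its quadratic models. -/
theorem IsSmoothWith.le_quadratic {d : ℕ} {L : ℝ} {f : EuclideanSpace ℝ (Fin d) → ℝ}
    (hf : IsSmoothWith L f) (x y : EuclideanSpace ℝ (Fin d)) :
    f y ≤ f x + inner ℝ (gradient f x) (y - x) + L / 2 * ‖y - x‖ ^ 2 := by
  obtain ⟨hd, hL⟩ := hf
  set v := y - x with hv
  have hline : ∀ t : ℝ, HasDerivAt (fun t : ℝ => x + t • v) v t := fun t => by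
    simpa using ((hasDerivAt_id t).smul_const v).const_add x
  have hder : ∀ t : ℝ, HasDerivAt
      (fun t : ℝ => f (x + t • v) - (t * inner ℝ (gradient f x) v + L / 2 * t ^ 2 * ‖v‖ ^ 2))
      (inner ℝ (gradient f (x + t • v)) v -
        (inner ℝ (gradient f x) v + L * t * ‖v‖ ^ 2)) t := fun t => by
    have h1 : HasDerivAt (fun t : ℝ => f (x + t • v)) (inner ℝ (gradient f (x + t • v)) v) t := by
      rw [inner_gradient_left]
      exact (hd (x + t • v)).hasFDerivAt.comp_hasDerivAt t (hline t)
    have h2 : HasDerivAt (fun t : ℝ => t * inner ℝ (gradient f x) v + L / 2 * t ^ 2 * ‖v‖ ^ 2)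
        (inner ℝ (gradient f x) v + L * t * ‖v‖ ^ 2) t := by
      have := ((hasDerivAt_id t).mul_const (inner ℝ (gradient f x) v)).add
        ((((hasDerivAt_id t).pow 2).const_mul (L / 2)).mul_const (‖v‖ ^ 2))
      exact this.congr_deriv (by simp only [id]; ring)
    exact h1.sub h2
  have hanti := antitoneOn_of_deriv_nonpos (convex_Icc (0 : ℝ) 1)
    (fun t _ => (hder t).continuousAt.continuousWithinAt)
    (fun t _ => (hder t).differentiableAt.differentiableWithinAt)
    (fun t ht => by
      rw [interior_Icc] at ht
      rw [(hder t).deriv]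
      have h1 : inner ℝ (gradient f (x + t • v) - gradient f x) v ≤ L * t * ‖v‖ ^ 2 := by
        refine (real_inner_le_norm _ _).trans ?_
        have h2 := hL (x + t • v) x
        rw [add_sub_cancel_left, norm_smul, Real.norm_of_nonneg ht.1.le] at h2
        nlinarith [mul_le_mul_of_nonneg_right h2 (norm_nonneg v)]
      rw [inner_sub_left] at h1
      linarith)
  have h01 := hanti (Set.left_mem_Icc.2 zero_le_one) (Set.right_mem_Icc.2 zero_le_one) zero_le_one
  have hxv : x + v = y := by rw [hv, add_sub_cancel]
  simp only [one_smul, zero_smul, add_zero, hxv] at h01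
  linarith

/-! ### Regularity and minimizers of the local subproblems -/

section ProxObjective

variable {d : ℕ} {f : EuclideanSpace ℝ (Fin d) → ℝ} {L μ lam : ℝ}

theorem norm_sub_sq_expand {E : Type*} [NormedAddCommGroup E] [InnerProductSpace ℝ E]
    (w x y : E) :
    ‖y - w‖ ^ 2 = ‖x - w‖ ^ 2 + 2 * inner ℝ (x - w) (y - x) + ‖y - x‖ ^ 2 := by
  rw [← norm_add_sq_real]
  congr 2
  abel

theorem gradient_proxObjective (hf : Differentiable ℝ f) (w z : EuclideanSpace ℝ (Fin d)) :
    gradient (proxObjective f lam w) z = gradient f z + lam • (z - w) := by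
  refine HasGradientAt.gradient ?_
  rw [hasGradientAt_iff_hasFDerivAt]
  have h1 := (hf z).hasGradientAt.hasFDerivAt
  have h2 := (((hasFDerivAt_id z).sub_const w).norm_sq).const_mul (lam / 2)
  refine (h1.add h2).congr_fderiv ?_
  ext v
  simp
  ring

theorem proxObjective_le_quadratic (hf : IsSmoothWith L f) (w x y : EuclideanSpace ℝ (Fin d)) :
    proxObjective f lam w y ≤ proxObjective f lam w x +
      inner ℝ (gradient (proxObjective f lam w) x) (y - x) + (L + lam) / 2 * ‖y - x‖ ^ 2 := by
  have h1 := hf.le_quadratic x y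
  rw [gradient_proxObjective hf.1, inner_add_left, real_inner_smul_left]
  have h2 := norm_sub_sq_expand w x y
  simp only [proxObjective, h2]
  linarith

theorem isStronglyConvexWith_proxObjective (hd : Differentiable ℝ f)
    (hf : IsStronglyConvexWith μ f) (w : EuclideanSpace ℝ (Fin d)) :
    IsStronglyConvexWith (μ + lam) (proxObjective f lam w) := by
  intro x y
  have h1 := hf x y
  rw [gradient_proxObjective hd, inner_add_left, real_inner_smul_left]
  have h2 := norm_sub_sq_expand w x y
  simp only [proxObjective, h2]
  linarith

/-- Strongly convex functions grow quadratically, up to a constant. -/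
theorem IsStronglyConvexWith.exists_const_add_le (hμ : 0 < μ) (hf : IsStronglyConvexWith μ f) :
    ∃ c : ℝ, ∀ x, c + μ / 4 * ‖x‖ ^ 2 ≤ f x := by
  refine ⟨f 0 - ‖gradient f 0‖ ^ 2 / μ, fun x => ?_⟩
  have h1 := hf 0 x
  rw [sub_zero] at h1
  have h2 := neg_le_of_abs_le (abs_real_inner_le_norm (gradient f 0) x)
  have h3 : 0 ≤ (2 * ‖gradient f 0‖ - μ * ‖x‖) ^ 2 / (4 * μ) := by positivity
  have h4 : (2 * ‖gradient f 0‖ - μ * ‖x‖) ^ 2 / (4 * μ) =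
      ‖gradient f 0‖ ^ 2 / μ - ‖gradient f 0‖ * ‖x‖ + μ / 4 * ‖x‖ ^ 2 := by
    field_simp
    ring
  linarith

theorem tendsto_atTop_of_quadratic_growth {E : Type*} [NormedAddCommGroup E] [ProperSpace E]
    {g : E → ℝ} {c a : ℝ} (ha : 0 < a) (h : ∀ x, c + a * ‖x‖ ^ 2 ≤ g x) :
    Filter.Tendsto g (Filter.cocompact E) Filter.atTop := by
  refine Filter.tendsto_atTop_mono h ?_
  refine Filter.tendsto_atTop_add_const_left _ _ (Filter.Tendsto.const_mul_atTop ha ?_)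
  exact (Filter.tendsto_pow_atTop two_ne_zero).comp (tendsto_norm_cocompact_atTop (E := E))

/-- The prox subproblem has a minimizer, and grows quadratically around it. -/
theorem exists_proxObjective_minimizer (hμ : 0 < μ) (hlam : 0 ≤ lam) (hd : Differentiable ℝ f)
    (hf : IsStronglyConvexWith μ f) (w : EuclideanSpace ℝ (Fin d)) :
    ∃ p, gradient (proxObjective f lam w) p = 0 ∧
      ∀ x, proxObjective f lam w p + (μ + lam) / 2 * ‖x - p‖ ^ 2 ≤ proxObjective f lam w x := by
  have hsc := isStronglyConvexWith_proxObjective (lam := lam) hd hf w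
  obtain ⟨c, hc⟩ := hsc.exists_const_add_le (by linarith)
  have hcont : Continuous (proxObjective f lam w) := by
    have := hd.continuous
    unfold proxObjective
    fun_prop
  obtain ⟨p, hp⟩ := hcont.exists_forall_le
    (tendsto_atTop_of_quadratic_growth (by linarith : 0 < (μ + lam) / 4) hc)
  have hg : gradient (proxObjective f lam w) p = 0 := by
    have : IsLocalMin (proxObjective f lam w) p := Filter.Eventually.of_forall hp
    rw [gradient, this.fderiv_eq_zero, map_zero]
  refine ⟨p, hg, fun x => ?_⟩
  have := hsc p x
  rw [hg, inner_zero_left, add_zero] at this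
  exact this

end ProxObjective

/-! ### Linear convergence of Nesterov's method on one client -/

section AcceleratedGradient

/-- One step of accelerated gradient descent contracts its Lyapunov function. -/
theorem accelerated_step {E : Type*} [NormedAddCommGroup E] [InnerProductSpace ℝ E]
    {h : E → ℝ} {m L θ : ℝ} (hm : 0 < m) (hθ : 0 < θ) (hθ1 : θ ≤ 1) (hL : L * θ ^ 2 = m)
    {u v z g p : E} (hv : (1 + θ) • v = u + θ • z)
    (hp : h v + inner ℝ g (p - v) + m / 2 * ‖p - v‖ ^ 2 ≤ h p)
    (hu : h v + inner ℝ g (u - v) + m / 2 * ‖u - v‖ ^ 2 ≤ h u)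
    (hdesc : h (v - (1 / L) • g) ≤ h v - 1 / (2 * L) * ‖g‖ ^ 2) :
    h (v - (1 / L) • g) - h p +
        m / 2 * ‖u + (1 / θ) • (v - (1 / L) • g - u) - p‖ ^ 2 ≤
      (1 - θ) * (h u - h p + m / 2 * ‖z - p‖ ^ 2) := by
  have hLpos : 0 < L := by
    by_contra hneg
    nlinarith [mul_nonneg (neg_nonneg.2 (not_lt.1 hneg)) (sq_nonneg θ)]
  obtain ⟨b, hb⟩ : ∃ b, b = v - u := ⟨_, rfl⟩
  obtain ⟨e, he⟩ : ∃ e, e = v - p := ⟨_, rfl⟩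
  have hz : z - p = e + (1 / θ) • b := by
    have : z = (1 / θ) • ((1 + θ) • v - u) := by
      rw [hv, add_sub_cancel_left, smul_smul, one_div, inv_mul_cancel₀ hθ.ne', one_smul]
    rw [this, he, hb]
    (match_scalars <;> field_simp); ring
  have hz' : u + (1 / θ) • (v - (1 / L) • g - u) - p =
      e + ((1 / θ - 1) • b - (θ / m) • g) := by
    rw [he, hb, ← hL]
    match_scalars <;> field_simp <;> ring
  have hpv : p - v = -e := by rw [he]; abel
  have huv : u - v = -b := by rw [hb]; abel
  rw [hz, hz']
  rw [hpv, norm_neg, inner_neg_right] at hp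
  rw [huv, norm_neg, inner_neg_right] at hu
  have h1 : ‖e + (1 / θ) • b‖ ^ 2 =
      ‖e‖ ^ 2 + 2 / θ * inner ℝ e b + 1 / θ ^ 2 * ‖b‖ ^ 2 := by
    rw [norm_add_sq_real, norm_smul, inner_smul_right, mul_pow, Real.norm_eq_abs, sq_abs]
    ring
  have h2 : ‖e + ((1 / θ - 1) • b - (θ / m) • g)‖ ^ 2 =
      ‖e‖ ^ 2 + 2 * ((1 / θ - 1) * inner ℝ e b - θ / m * inner ℝ g e) +
      ((1 / θ - 1) ^ 2 * ‖b‖ ^ 2 - 2 * ((1 / θ - 1) * (θ / m)) * inner ℝ g b +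
        (θ / m) ^ 2 * ‖g‖ ^ 2) := by
    rw [norm_add_sq_real, norm_sub_sq_real, inner_sub_right, norm_smul, norm_smul, inner_smul_left,
      inner_smul_right, inner_smul_right, inner_smul_right, mul_pow, mul_pow, Real.norm_eq_abs,
      Real.norm_eq_abs, sq_abs, sq_abs, real_inner_comm g e, real_inner_comm g b]
    simp only [conj_trivial]
    ring
  have hLi : 1 / (2 * L) = θ ^ 2 / (2 * m) := by
    rw [← hL]
    field_simp
  rw [hLi] at hdesc
  rw [h1, h2]
  -- The inequality at `p` is used with weight `θ` and the one at `u` with weight `1 - θ`. The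
  -- `‖g‖²` term is exactly the guaranteed descent, and what remains is a nonnegative multiple of
  -- `‖v - u‖²`.
  have hdiff : (1 - θ) * (m / 2 * (‖e‖ ^ 2 + 2 / θ * inner ℝ e b + 1 / θ ^ 2 * ‖b‖ ^ 2)) -
      m / 2 * (‖e‖ ^ 2 + 2 * ((1 / θ - 1) * inner ℝ e b - θ / m * inner ℝ g e) +
      ((1 / θ - 1) ^ 2 * ‖b‖ ^ 2 - 2 * ((1 / θ - 1) * (θ / m)) * inner ℝ g b +
        (θ / m) ^ 2 * ‖g‖ ^ 2)) =
      θ * (inner ℝ g e - m / 2 * ‖e‖ ^ 2) +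
        (1 - θ) * (inner ℝ g b - m / 2 * ‖b‖ ^ 2) - θ ^ 2 / (2 * m) * ‖g‖ ^ 2 +
        m / 2 * ((1 - θ) * (1 + 1 / θ) * ‖b‖ ^ 2) := by
    field_simp
    ring
  have hpos : 0 ≤ m / 2 * ((1 - θ) * (1 + 1 / θ) * ‖b‖ ^ 2) := by
    have := sub_nonneg.2 hθ1
    positivity
  have h3 := mul_le_mul_of_nonneg_left hp hθ.le
  have h4 := mul_le_mul_of_nonneg_left hu (sub_nonneg.2 hθ1)
  linarith

variable {d : ℕ} {h : EuclideanSpace ℝ (Fin d) → ℝ} {L m : ℝ}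

theorem agdRun_succ (h : EuclideanSpace ℝ (Fin d) → ℝ) (L m : ℝ)
    (z : EuclideanSpace ℝ (Fin d)) (T : ℕ) :
    agdRun h L m z (T + 1) = agdStep h L m (agdRun h L m z T) := by
  simp only [agdRun, Function.iterate_succ_apply']

theorem agdRun_grads (h : EuclideanSpace ℝ (Fin d) → ℝ) (L m : ℝ)
    (z : EuclideanSpace ℝ (Fin d)) (T : ℕ) : (agdRun h L m z T).grads = T := by
  induction T with
  | zero => rfl
  | succ T ih => rw [agdRun_succ, agdStep, ih]

/-- Linear convergence of accelerated gradient descent on a smooth strongly convex function. -/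
theorem agdRun_iter_le (hm : 0 < m) (hmL : m ≤ L) (hsc : IsStronglyConvexWith m h)
    (hsm : ∀ x y, h y ≤ h x + inner ℝ (gradient h x) (y - x) + L / 2 * ‖y - x‖ ^ 2)
    (z₀ p : EuclideanSpace ℝ (Fin d)) (T : ℕ) :
    ∃ z, (1 + √(m / L)) • (agdRun h L m z₀ T).extra =
        (agdRun h L m z₀ T).iter + √(m / L) • z ∧
      h (agdRun h L m z₀ T).iter - h p + m / 2 * ‖z - p‖ ^ 2 ≤
        (1 - √(m / L)) ^ T * (h z₀ - h p + m / 2 * ‖z₀ - p‖ ^ 2) := by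
  have hL : 0 < L := hm.trans_le hmL
  have hθ : 0 < √(m / L) := Real.sqrt_pos.2 (by positivity)
  have hθ1 : √(m / L) ≤ 1 := by
    exact Real.sqrt_le_one.2 ((div_le_one hL).2 hmL)
  have hθ2 : L * √(m / L) ^ 2 = m := by
    rw [Real.sq_sqrt (by positivity)]
    field_simp
  have hinv : √(L / m) = 1 / √(m / L) := by
    rw [← inv_div m L, Real.sqrt_inv, one_div]
  set θ := √(m / L)
  induction T with
  | zero => exact ⟨z₀, by simp [agdRun, add_smul], by simp [agdRun]⟩
  | succ T ih =>
    obtain ⟨z, hv, hV⟩ := ih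
    rw [agdRun_succ]
    set s := agdRun h L m z₀ T
    -- The auxiliary point prolongs the last move by the factor `1 / θ`; with it, the momentum rule
    -- is the coupling `(1 + θ) v = u + θ z`.
    refine ⟨s.iter + (1 / θ) • (s.extra - (1 / L) • gradient h s.extra - s.iter), ?_, ?_⟩
    · simp only [agdStep, hinv]
      match_scalars <;> field_simp <;> ring
    · have hstep := accelerated_step (h := h) (p := p) hm hθ hθ1 hθ2 hv (hsc s.extra p)
        (hsc s.extra s.iter) (by
          refine (hsm s.extra _).trans (le_of_eq ?_)
          rw [sub_sub_cancel_left, inner_neg_right, norm_neg, norm_smul, inner_smul_right,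
            real_inner_self_eq_norm_sq, Real.norm_of_nonneg (by positivity)]
          field_simp
          ring)
      refine hstep.trans ?_
      rw [pow_succ' (1 - θ), mul_assoc]
      exact mul_le_mul_of_nonneg_left hV (sub_nonneg.2 hθ1)

/-- Accuracy of `T` steps of accelerated gradient descent, in terms of the initial distance. -/
theorem agdRun_gap_le (hm : 0 < m) (hmL : m ≤ L) (hsc : IsStronglyConvexWith m h)
    (hsm : ∀ x y, h y ≤ h x + inner ℝ (gradient h x) (y - x) + L / 2 * ‖y - x‖ ^ 2)
    {p : EuclideanSpace ℝ (Fin d)} (hp : gradient h p = 0) (z₀ : EuclideanSpace ℝ (Fin d))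
    (T : ℕ) :
    h (agdRun h L m z₀ T).iter - h p ≤
      Real.exp (-(√(m / L) * T)) * (L * ‖z₀ - p‖ ^ 2) := by
  obtain ⟨z, -, hz⟩ := agdRun_iter_le hm hmL hsc hsm z₀ p T
  have hθ1 : √(m / L) ≤ 1 := by
    exact Real.sqrt_le_one.2 ((div_le_one (hm.trans_le hmL)).2 hmL)
  have h1 := hsm p z₀
  rw [hp, inner_zero_left, add_zero] at h1
  have h2 : 0 ≤ m / 2 * ‖z - p‖ ^ 2 := by positivity
  have h3 : h z₀ - h p + m / 2 * ‖z₀ - p‖ ^ 2 ≤ L * ‖z₀ - p‖ ^ 2 := by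
    nlinarith [mul_le_mul_of_nonneg_right hmL (sq_nonneg ‖z₀ - p‖)]
  have h4 : (1 - √(m / L)) ^ T ≤ Real.exp (-(√(m / L) * T)) := by
    calc (1 - √(m / L)) ^ T ≤ Real.exp (-√(m / L)) ^ T :=
          pow_le_pow_left₀ (sub_nonneg.2 hθ1) (Real.one_sub_le_exp_neg _) _
      _ = Real.exp (-(√(m / L) * T)) := by
          rw [← Real.exp_nat_mul]
          congr 1
          ring
  calc h (agdRun h L m z₀ T).iter - h p
      ≤ (1 - √(m / L)) ^ T * (h z₀ - h p + m / 2 * ‖z₀ - p‖ ^ 2) := by linarith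
    _ ≤ (1 - √(m / L)) ^ T * (L * ‖z₀ - p‖ ^ 2) :=
        mul_le_mul_of_nonneg_left h3 (pow_nonneg (sub_nonneg.2 hθ1) _)
    _ ≤ _ := mul_le_mul_of_nonneg_right h4
        (mul_nonneg (hm.le.trans hmL) (sq_nonneg _))

end AcceleratedGradient

/-! ### One inexact accelerated proximal step -/

section AcceleratedProx

variable {H : Type*} [NormedAddCommGroup H] [InnerProductSpace ℝ H]

theorem two_mul_inner_le_young {t : ℝ} (ht : 0 < t) (a : ℝ) (u v : H) :
    2 * (a * inner ℝ u v) ≤ t * ‖u‖ ^ 2 + a ^ 2 / t * ‖v‖ ^ 2 := by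
  have h : 0 ≤ t * ‖u - (a / t) • v‖ ^ 2 := by positivity
  rw [norm_sub_sq_real, norm_smul, inner_smul_right, mul_pow, Real.norm_eq_abs, sq_abs] at h
  have h2 : t * (‖u‖ ^ 2 - 2 * (a / t * inner ℝ u v) + (a / t) ^ 2 * ‖v‖ ^ 2) =
      t * ‖u‖ ^ 2 + a ^ 2 / t * ‖v‖ ^ 2 - 2 * (a * inner ℝ u v) := by
    field_simp
    ring
  linarith

theorem norm_combo_sq (s : ℝ) (u v : H) :
    ‖(1 - s) • u + s • v‖ ^ 2 + s * (1 - s) * ‖u - v‖ ^ 2 =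
      (1 - s) * ‖u‖ ^ 2 + s * ‖v‖ ^ 2 := by
  rw [norm_add_sq_real, norm_sub_sq_real, norm_smul, norm_smul, inner_smul_left, inner_smul_right,
    mul_pow, mul_pow, Real.norm_eq_abs, Real.norm_eq_abs, sq_abs, sq_abs]
  simp only [conj_trivial]
  ring

/-- The Lyapunov form is nonpositive on the range of the projection. -/
theorem lyapunov_form_nonpos {s ρ : ℝ} (hs : 0 < s) (hρ : 0 < ρ) (hc : (1 - s) ^ 2 < ρ)
    (hcond : 2 * (ρ - (1 - s) ^ 2) + ρ * (s ^ 2 * (1 + s ^ 2) ^ 2) ≤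
      2 * (ρ - (1 - s) ^ 2) * ρ * ((1 + 3 / 2 * s ^ 2) * (1 + s) ^ 2)) (x z z' : H) :
    2 / (1 + s) * inner ℝ (z + s • x) z' - (1 + s ^ 2) * ‖z'‖ ^ 2 -
        1 / 2 * ‖(1 - s) • x + s • z'‖ ^ 2 - ρ * ‖z‖ ^ 2 +
        ((1 - s) ^ 2 - ρ / 2) * ‖x‖ ^ 2 ≤ 0 := by
  have hc' : 0 < ρ - (1 - s) ^ 2 := sub_pos.2 hc
  have h1 := two_mul_inner_le_young hρ (1 / (1 + s)) z z'
  have h2 := two_mul_inner_le_young (half_pos hc') (s * (1 + s ^ 2) / (2 * (1 + s))) x z'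
  rw [norm_add_sq_real, norm_smul, norm_smul, inner_smul_left, inner_smul_right, inner_add_left,
    inner_smul_left, mul_pow, mul_pow, Real.norm_eq_abs, Real.norm_eq_abs, sq_abs, sq_abs]
  simp only [conj_trivial]
  -- The Young weights `ρ` and `(ρ - (1 - s)²) / 2` use up the available `‖z‖²` and `‖x‖²` exactly.
  -- The budget for `‖z'‖²` is `1 + s²` plus `s²/2` from the expanded square; `hcond` is this
  -- inequality with denominators cleared.
  have h3 : (1 / (1 + s)) ^ 2 / ρ +
      (s * (1 + s ^ 2) / (2 * (1 + s))) ^ 2 / ((ρ - (1 - s) ^ 2) / 2) ≤ 1 + 3 / 2 * s ^ 2 := by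
    have : (1 / (1 + s)) ^ 2 / ρ +
        (s * (1 + s ^ 2) / (2 * (1 + s))) ^ 2 / ((ρ - (1 - s) ^ 2) / 2) =
        (2 * (ρ - (1 - s) ^ 2) + ρ * (s ^ 2 * (1 + s ^ 2) ^ 2)) /
          (2 * (ρ - (1 - s) ^ 2) * ρ * (1 + s) ^ 2) := by
      field_simp
    rw [this, div_le_iff₀ (by positivity)]
    linarith only [hcond]
  have h4 := mul_le_mul_of_nonneg_right h3 (sq_nonneg ‖z'‖)
  have h5 : 2 / (1 + s) * (inner ℝ z z' + s * inner ℝ x z') =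
      2 * (1 / (1 + s) * inner ℝ z z') + 2 * (s * (1 + s ^ 2) / (2 * (1 + s)) * inner ℝ x z') +
        (1 - s) * s * inner ℝ x z' := by
    field_simp
    ring
  rw [h5]
  generalize (1 / (1 + s)) ^ 2 / ρ = c₁ at h1 h4
  generalize (s * (1 + s ^ 2) / (2 * (1 + s))) ^ 2 / ((ρ - (1 - s) ^ 2) / 2) = c₂ at h2 h4
  linarith only [h1, h2, h4]

/-- A regularized composite objective `f + (lam/2) ‖· - P ·‖²`. -/
noncomputable def compositeObjective (f : H → ℝ) (lam : ℝ) (P : H →ₗ[ℝ] H) (x : H) : ℝ :=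
  f x + lam / 2 * ‖x - P x‖ ^ 2

variable {f : H → ℝ} {μ lam : ℝ} {P : H →ₗ[ℝ] H}

/-- Pythagoras with `P y` in the range of `P`. It turns the subproblem centred at `P y` into the
composite objective plus `(lam/2) ‖P (x - y)‖²`. -/
theorem norm_sub_proj_sq (hP : ∀ x, P (P x) = P x)
    (hPn : ∀ x, ‖x‖ ^ 2 = ‖P x‖ ^ 2 + ‖x - P x‖ ^ 2) (x y : H) :
    ‖x - P y‖ ^ 2 = ‖P (x - y)‖ ^ 2 + ‖x - P x‖ ^ 2 := by
  rw [hPn (x - P y), map_sub, hP, sub_sub_sub_cancel_right, map_sub]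

/-- The basic inequality of the inexact proximal gradient step from `y` to `x'`, where `p` is the
exact step and `δ` the accuracy. -/
theorem prox_step_inequality (hP : ∀ x, P (P x) = P x)
    (hPn : ∀ x, ‖x‖ ^ 2 = ‖P x‖ ^ 2 + ‖x - P x‖ ^ 2) {y p x' : H} {δ : ℝ}
    (hp : ∀ x, f p + lam / 2 * ‖p - P y‖ ^ 2 + (μ + lam) / 2 * ‖x - p‖ ^ 2 ≤
      f x + lam / 2 * ‖x - P y‖ ^ 2)
    (hx' : f x' + lam / 2 * ‖x' - P y‖ ^ 2 ≤ f p + lam / 2 * ‖p - P y‖ ^ 2 + δ) (x : H) :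
    compositeObjective f lam P x' - δ + (μ + lam) / 2 * ‖x - p‖ ^ 2 -
        lam / 2 * ‖P (x - y)‖ ^ 2 + lam / 2 * ‖P (x' - y)‖ ^ 2 ≤ compositeObjective f lam P x := by
  have h1 := hp x
  rw [norm_sub_proj_sq hP hPn x] at h1
  rw [norm_sub_proj_sq hP hPn x'] at hx'
  unfold compositeObjective
  linarith

/-- A minimizer of the composite objective is a fixed point of the exact step, and the objective
grows quadratically around it. -/
theorem compositeObjective_growth (hμ : 0 < μ) (hlam : 0 < lam) (hP : ∀ x, P (P x) = P x)
    (hPn : ∀ x, ‖x‖ ^ 2 = ‖P x‖ ^ 2 + ‖x - P x‖ ^ 2) {xs p : H}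
    (hxs : ∀ x, compositeObjective f lam P xs ≤ compositeObjective f lam P x)
    (hp : ∀ x, f p + lam / 2 * ‖p - P xs‖ ^ 2 + (μ + lam) / 2 * ‖x - p‖ ^ 2 ≤
      f x + lam / 2 * ‖x - P xs‖ ^ 2) (x : H) :
    compositeObjective f lam P xs + μ / 2 * ‖x - xs‖ ^ 2 ≤ compositeObjective f lam P x := by
  have h1 := prox_step_inequality hP hPn hp (δ := 0) (by linarith) xs
  have h2 := prox_step_inequality hP hPn hp (δ := 0) (by linarith) x
  have h3 := hxs p
  rw [sub_self xs, map_zero, norm_zero] at h1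
  have h4 : 0 ≤ lam / 2 * ‖P (p - xs)‖ ^ 2 := by positivity
  -- Minimality of `xs` leaves no room for the exact step from `xs` to move, so `p = xs`. The step
  -- inequality at `x` then gives growth, since `P` is nonexpansive.
  have h5 : (μ + lam) / 2 * ‖xs - p‖ ^ 2 ≤ 0 := by linarith
  have h6 : ‖xs - p‖ ^ 2 = 0 :=
    le_antisymm (nonpos_of_mul_nonpos_right h5 (by linarith)) (sq_nonneg _)
  obtain rfl : xs = p := by simpa [sub_eq_zero] using h6
  have h7 := hPn (x - xs)
  nlinarith [sq_nonneg ‖x - xs - P (x - xs)‖]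

/-- The exact step moves by at most twice the distance to a minimizer. -/
theorem norm_sub_prox_sq_le (hμ : 0 < μ) (hlam : 0 < lam) (hP : ∀ x, P (P x) = P x)
    (hPn : ∀ x, ‖x‖ ^ 2 = ‖P x‖ ^ 2 + ‖x - P x‖ ^ 2) {xs y p : H}
    (hxs : ∀ x, compositeObjective f lam P xs ≤ compositeObjective f lam P x)
    (hp : ∀ x, f p + lam / 2 * ‖p - P y‖ ^ 2 + (μ + lam) / 2 * ‖x - p‖ ^ 2 ≤
      f x + lam / 2 * ‖x - P y‖ ^ 2) :
    ‖y - p‖ ^ 2 ≤ 4 * ‖y - xs‖ ^ 2 := by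
  have h1 := prox_step_inequality hP hPn hp (δ := 0) (by linarith) xs
  have h2 := hxs p
  have h3 := hPn (xs - y)
  have h4 : 0 ≤ lam / 2 * ‖P (p - y)‖ ^ 2 := by positivity
  have h5 : 0 ≤ lam / 2 * ‖xs - y - P (xs - y)‖ ^ 2 := by positivity
  have h6 : lam * ‖xs - p‖ ^ 2 ≤ lam * ‖y - xs‖ ^ 2 := by
    rw [norm_sub_rev y xs, h3]
    nlinarith [mul_nonneg hμ.le (sq_nonneg ‖xs - p‖)]
  have h7 : ‖xs - p‖ ≤ ‖y - xs‖ :=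
    le_of_sq_le_sq (le_of_mul_le_mul_left h6 hlam) (norm_nonneg _)
  have h8 : ‖y - p‖ ≤ ‖y - xs‖ + ‖xs - p‖ := by
    simpa using norm_add_le (y - xs) (xs - p)
  calc ‖y - p‖ ^ 2 ≤ (2 * ‖y - xs‖) ^ 2 :=
        pow_le_pow_left₀ (norm_nonneg _) (by linarith) 2
    _ = 4 * ‖y - xs‖ ^ 2 := by ring

/-- One inexact accelerated step contracts the Lyapunov function, up to the error terms. -/
theorem accelerated_prox_step {s ρ : ℝ} (hs : 0 < s) (hs1 : s ≤ 1) (hμ : 0 < μ)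
    (hlam : lam * s ^ 2 = μ)
    (hρs : 1 - s ≤ ρ) (hρ : 0 < ρ) (hc : (1 - s) ^ 2 < ρ)
    (hcond : 2 * (ρ - (1 - s) ^ 2) + ρ * (s ^ 2 * (1 + s ^ 2) ^ 2) ≤
      2 * (ρ - (1 - s) ^ 2) * ρ * ((1 + 3 / 2 * s ^ 2) * (1 + s) ^ 2))
    (hP : ∀ x, P (P x) = P x) (hPn : ∀ x, ‖x‖ ^ 2 = ‖P x‖ ^ 2 + ‖x - P x‖ ^ 2)
    {x y z x' z' p xs : H} {δ : ℝ}
    (hgrow : compositeObjective f lam P xs + μ / 2 * ‖x - xs‖ ^ 2 ≤ compositeObjective f lam P x)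
    (hp : ∀ x, f p + lam / 2 * ‖p - P y‖ ^ 2 + (μ + lam) / 2 * ‖x - p‖ ^ 2 ≤
      f x + lam / 2 * ‖x - P y‖ ^ 2)
    (hx' : f x' + lam / 2 * ‖x' - P y‖ ^ 2 ≤ f p + lam / 2 * ‖p - P y‖ ^ 2 + δ)
    (hy : (1 + s) • y = x + s • z) (hz' : x' = (1 - s) • x + s • z') :
    compositeObjective f lam P x' - compositeObjective f lam P xs + μ / 2 * ‖z' - xs‖ ^ 2 -
        μ / 4 * ‖x' - xs‖ ^ 2 ≤
      ρ * (compositeObjective f lam P x - compositeObjective f lam P xs +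
        μ / 2 * ‖z - xs‖ ^ 2 - μ / 4 * ‖x - xs‖ ^ 2) + δ +
        (μ + lam) * s * (‖z' - xs‖ * ‖x' - p‖) := by
  have hI1 := prox_step_inequality hP hPn hp hx' xs
  have hI2 := prox_step_inequality hP hPn hp hx' x
  obtain ⟨X, hX⟩ : ∃ X, X = x - xs := ⟨_, rfl⟩
  obtain ⟨Z, hZ⟩ : ∃ Z, Z = z - xs := ⟨_, rfl⟩
  obtain ⟨Z', hZ'⟩ : ∃ Z', Z' = z' - xs := ⟨_, rfl⟩
  obtain ⟨W, hW⟩ : ∃ W, W = (1 / (1 + s)) • (Z + s • X) := ⟨_, rfl⟩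
  have hlampos : 0 < lam := by
    by_contra hneg
    nlinarith [mul_nonneg (neg_nonneg.2 (not_lt.1 hneg)) (sq_nonneg s)]
  have hy' : y = (1 / (1 + s)) • (x + s • z) := by
    rw [← hy, smul_smul, one_div, inv_mul_cancel₀ (by positivity), one_smul]
  have hxp : x' - xs = (1 - s) • X + s • Z' := by
    rw [hz', hX, hZ']
    match_scalars <;> ring
  have h1 := norm_combo_sq s (x - p) (xs - p)
  have h2 := norm_combo_sq s (P (x - y)) (P (xs - y))
  have e1 : (1 - s) • (x - p) + s • (xs - p) = (x' - p) - s • Z' := by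
    rw [hz', hZ']
    match_scalars <;> ring
  have e2 : (1 - s) • P (x - y) + s • P (xs - y) = s • -P W := by
    rw [← map_smul, ← map_smul, ← map_add, ← map_neg, ← map_smul, hW, hX, hZ, hy']
    congr 1
    match_scalars <;> field_simp <;> ring
  have e3 : P (x' - y) = s • (P Z' - P W) := by
    rw [← map_sub, ← map_smul, hW, hX, hZ, hZ', hy', hz']
    congr 1
    match_scalars <;> field_simp <;> ring
  have e4 : P (x - y) - P (xs - y) = P X := by
    rw [← map_sub, hX]
    congr 1
    abel
  rw [e1, sub_sub_sub_cancel_right, ← hX] at h1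
  rw [e2, e4] at h2
  rw [e3] at hI1 hI2
  rw [← hX] at hgrow
  rw [hxp, ← hX, ← hZ, ← hZ']
  -- The curvature term is centred at the exact step `p`. Recentring it at `x'` costs a
  -- Cauchy–Schwarz cross term, the source of the last error term.
  have h3 : s ^ 2 * ‖Z'‖ ^ 2 - 2 * s * (‖Z'‖ * ‖x' - p‖) ≤ ‖x' - p - s • Z'‖ ^ 2 := by
    rw [norm_sub_sq_real, norm_smul, inner_smul_right, mul_pow, Real.norm_of_nonneg hs.le]
    have := mul_le_mul_of_nonneg_left (real_inner_le_norm (x' - p) Z') hs.le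
    nlinarith [sq_nonneg ‖x' - p‖]
  have n1 : ‖s • -P W‖ ^ 2 = s ^ 2 * ‖P W‖ ^ 2 := by
    rw [norm_smul, norm_neg, mul_pow, Real.norm_of_nonneg hs.le]
  have n2 : ‖s • (P Z' - P W)‖ ^ 2 =
      s ^ 2 * (‖P Z'‖ ^ 2 - 2 * inner ℝ (P W) (P Z') + ‖P W‖ ^ 2) := by
    rw [norm_smul, mul_pow, Real.norm_of_nonneg hs.le, norm_sub_sq_real, real_inner_comm]
  have n3 : 2 * inner ℝ (P W) (P Z') = 2 / (1 + s) * inner ℝ (P Z + s • P X) (P Z') := by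
    rw [hW, map_smul, map_add, map_smul, real_inner_smul_left]
    ring
  rw [n1] at h2
  rw [n2] at hI1 hI2
  have hform := lyapunov_form_nonpos hs hρ hc hcond (P X) (P Z) (P Z')
  rw [← n3] at hform
  have d1 := hPn X
  have d2 := hPn Z
  have d3 := hPn Z'
  have d4 := hPn ((1 - s) • X + s • Z')
  rw [map_add, map_smul, map_smul] at d4
  rw [d1] at h1 hgrow
  rw [d3] at h3
  rw [d1, d2, d3, d4]
  -- The weights `s` at `xs` and `1 - s` at `x` match `x' = (1 - s) x + s z'`. The surplus `ρ - (1 -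
  -- s)` of the gap is spent on quadratic growth. The `P`-components then form `μ/2` times the
  -- Lyapunov form, and the components orthogonal to the range of `P` have favourable sign.
  have hcomb := add_le_add (mul_le_mul_of_nonneg_left hI1 hs.le)
    (mul_le_mul_of_nonneg_left hI2 (sub_nonneg.2 hs1))
  have hg := mul_le_mul_of_nonneg_left hgrow (by linarith : 0 ≤ ρ - (1 - s))
  have hform' := mul_le_mul_of_nonneg_left hform (by positivity : 0 ≤ μ / 2)
  have h1' := congrArg (fun t => (μ + lam) / 2 * t) h1
  have h2' := congrArg (fun t => lam / 2 * t) h2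
  have h3' := mul_le_mul_of_nonneg_left h3 (by positivity : 0 ≤ (μ + lam) / 2)
  have hQx : 0 ≤ lam * (s * (1 - s) * (1 - s + s ^ 2)) * ‖X - P X‖ ^ 2 := by
    have := sub_nonneg.2 hs1
    positivity
  have hQx' : 0 ≤ μ * ρ * ‖X - P X‖ ^ 2 := by positivity
  have hQz : 0 ≤ μ * ρ * ‖Z - P Z‖ ^ 2 := by positivity
  have hQz' : 0 ≤ μ * s ^ 2 * ‖Z' - P Z'‖ ^ 2 := by positivity
  have hQ4 : 0 ≤ μ * ‖(1 - s) • X + s • Z' - ((1 - s) • P X + s • P Z')‖ ^ 2 := by positivity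
  subst hlam
  linarith

end AcceleratedProx

/-! ### Contraction of the Lyapunov function under relative errors -/

section Lyapunov

variable {H : Type*} [NormedAddCommGroup H] [InnerProductSpace ℝ H]

/-- The Lyapunov function of the accelerated proximal gradient method. -/
noncomputable def proxLyapunov (f : H → ℝ) (μ lam : ℝ) (P : H →ₗ[ℝ] H) (xs x z : H) : ℝ :=
  compositeObjective f lam P x - compositeObjective f lam P xs + μ / 2 * ‖z - xs‖ ^ 2 -
    μ / 4 * ‖x - xs‖ ^ 2

variable {f : H → ℝ} {μ lam : ℝ} {P : H →ₗ[ℝ] H}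

/-- Quadratic growth lets half of the gap absorb the negative term. -/
theorem le_proxLyapunov {xs x : H} (z : H)
    (hgrow : compositeObjective f lam P xs + μ / 2 * ‖x - xs‖ ^ 2 ≤ compositeObjective f lam P x) :
    (compositeObjective f lam P x - compositeObjective f lam P xs) / 2 + μ / 2 * ‖z - xs‖ ^ 2 ≤
      proxLyapunov f μ lam P xs x z := by
  unfold proxLyapunov
  linarith

theorem proxLyapunov_self_le {xs x : H}
    (hgrow : compositeObjective f lam P xs + μ / 2 * ‖x - xs‖ ^ 2 ≤ compositeObjective f lam P x) :
    proxLyapunov f μ lam P xs x x ≤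
      3 / 2 * (compositeObjective f lam P x - compositeObjective f lam P xs) := by
  unfold proxLyapunov
  linarith

/-- The squared distance of the extrapolated point to the exact step from it is controlled by the
Lyapunov function. -/
theorem norm_sub_prox_sq_le_proxLyapunov (hμ : 0 < μ) (hlam : 0 < lam)
    (hP : ∀ x, P (P x) = P x) (hPn : ∀ x, ‖x‖ ^ 2 = ‖P x‖ ^ 2 + ‖x - P x‖ ^ 2) {s : ℝ}
    (hs : 0 < s) {x y z p xs : H}
    (hxs : ∀ x, compositeObjective f lam P xs ≤ compositeObjective f lam P x)
    (hgrow : compositeObjective f lam P xs + μ / 2 * ‖x - xs‖ ^ 2 ≤ compositeObjective f lam P x)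
    (hp : ∀ x, f p + lam / 2 * ‖p - P y‖ ^ 2 + (μ + lam) / 2 * ‖x - p‖ ^ 2 ≤
      f x + lam / 2 * ‖x - P y‖ ^ 2)
    (hy : (1 + s) • y = x + s • z) :
    ‖y - p‖ ^ 2 ≤ 16 / μ * proxLyapunov f μ lam P xs x z := by
  have h1 := norm_sub_prox_sq_le hμ hlam hP hPn hxs hp
  have h2 := le_proxLyapunov z hgrow
  have h3 : (1 + s) ^ 2 * ‖y - xs‖ ^ 2 + s * ‖(x - xs) - (z - xs)‖ ^ 2 =
      (1 + s) * (‖x - xs‖ ^ 2 + s * ‖z - xs‖ ^ 2) := by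
    have e : (1 + s) • (y - xs) = (x - xs) + s • (z - xs) := by
      rw [smul_sub, hy]
      match_scalars <;> ring
    have e2 : (1 + s) ^ 2 * ‖y - xs‖ ^ 2 = ‖(1 + s) • (y - xs)‖ ^ 2 := by
      rw [norm_smul, mul_pow, Real.norm_eq_abs, sq_abs]
    rw [e2, e, norm_add_sq_real, norm_sub_sq_real (x - xs) (z - xs), norm_smul, inner_smul_right, mul_pow,
      Real.norm_eq_abs, sq_abs]
    ring
  set V := proxLyapunov f μ lam P xs x z
  -- `y` is a convex combination of `x` and `z`, and both lie within squared distance `4 V / μ` of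
  -- `xs`.
  have h4 : μ * ((1 + s) ^ 2 * ‖y - xs‖ ^ 2) ≤ (1 + s) ^ 2 * (4 * V) := by
    have h5 : μ * ‖x - xs‖ ^ 2 ≤ 4 * V := by nlinarith [mul_nonneg hμ.le (sq_nonneg ‖z - xs‖)]
    have h6 : μ * ‖z - xs‖ ^ 2 ≤ 4 * V := by
      nlinarith [mul_nonneg hμ.le (sq_nonneg ‖z - xs‖), mul_nonneg hμ.le (sq_nonneg ‖x - xs‖)]
    have h7 := mul_le_mul_of_nonneg_left h6 hs.le
    have h8 := mul_le_mul_of_nonneg_left (add_le_add h5 h7) (by positivity : 0 ≤ 1 + s)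
    have h9 : 0 ≤ μ * (s * ‖(x - xs) - (z - xs)‖ ^ 2) := by positivity
    have h10 := congrArg (fun t => μ * t) h3
    linarith
  have h5 : μ * ‖y - xs‖ ^ 2 ≤ 4 * V :=
    le_of_mul_le_mul_left (by linarith) (by positivity : 0 < (1 + s) ^ 2)
  rw [div_mul_eq_mul_div, le_div_iff₀ hμ]
  nlinarith

/-- A contraction with a small multiplicative perturbation of both sides. -/
theorem le_mul_exp_of_perturbed {V V' ρ τ : ℝ} (hV : 0 ≤ V) (hV' : 0 ≤ V') (hρ : 2 / 5 ≤ ρ)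
    (hτ0 : 0 ≤ τ) (hτ1 : τ ≤ 1 / 12)
    (h : V' ≤ ρ * V + τ ^ 2 * V + 3 / 2 * τ * (V + V')) :
    V' ≤ ρ * Real.exp (36 / 5 * τ) * V := by
  -- For `τ ≤ 1/12`, `u` dominates `τ² + 3τ/2`. As `ρ ≥ 2/5`, `(ρ + u)/(1 - u) ≤ ρ (1 + 9u/2)`, and
  -- `9u/2 = 36τ/5`.
  obtain ⟨u, hu⟩ : ∃ u, u = 8 / 5 * τ := ⟨_, rfl⟩
  have hu0 : 0 ≤ u := by rw [hu]; positivity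
  have hu1 : u ≤ 2 / 15 := by rw [hu]; linarith
  have hmain : (1 - u) * V' ≤ (ρ + u) * V := by
    have h1 : τ ^ 2 * V ≤ 1 / 12 * τ * V := by
      refine mul_le_mul_of_nonneg_right ?_ hV
      rw [sq]
      exact mul_le_mul_of_nonneg_right hτ1 hτ0
    have h2 : 0 ≤ τ * V := by positivity
    have h3 : 0 ≤ τ * V' := by positivity
    rw [hu]
    linarith
  have hexp : 1 + 9 / 2 * u ≤ Real.exp (36 / 5 * τ) := by
    have h := Real.add_one_le_exp (36 / 5 * τ)
    rw [hu]
    linarith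
  have hfac : ρ + u ≤ (1 - u) * (ρ * Real.exp (36 / 5 * τ)) := by
    have h1 : 0 ≤ (ρ - 2 / 5) * u := mul_nonneg (by linarith) hu0
    have h2 : 1 + 5 / 2 * u ≤ (1 - u) * (1 + 9 / 2 * u) := by
      have : 0 ≤ u * (2 / 15 - u) := mul_nonneg hu0 (by linarith)
      linarith
    have h3 := mul_le_mul_of_nonneg_left h2 (by linarith : 0 ≤ ρ)
    have h4 := mul_le_mul_of_nonneg_left hexp
      (mul_nonneg (by linarith : 0 ≤ 1 - u) (by linarith : 0 ≤ ρ))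
    linarith
  have h5 := mul_le_mul_of_nonneg_right hfac hV
  refine le_of_mul_le_mul_left ?_ (by linarith : 0 < 1 - u)
  linarith

/-- Contraction of the Lyapunov function by one inexact step of relative accuracy `(s r / 12)²`. -/
theorem proxLyapunov_step {s ρ r : ℝ} (hs : 0 < s) (hs1 : s ≤ 1) (hμ : 0 < μ)
    (hlam : lam * s ^ 2 = μ) (hr : 0 ≤ r) (hr1 : r ≤ 1)
    (hρs : 1 - s ≤ ρ) (hρ : 2 / 5 ≤ ρ) (hc : (1 - s) ^ 2 < ρ)
    (hcond : 2 * (ρ - (1 - s) ^ 2) + ρ * (s ^ 2 * (1 + s ^ 2) ^ 2) ≤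
      2 * (ρ - (1 - s) ^ 2) * ρ * ((1 + 3 / 2 * s ^ 2) * (1 + s) ^ 2))
    (hP : ∀ x, P (P x) = P x) (hPn : ∀ x, ‖x‖ ^ 2 = ‖P x‖ ^ 2 + ‖x - P x‖ ^ 2)
    {x y z x' z' p xs : H}
    (hgrow : ∀ x,
      compositeObjective f lam P xs + μ / 2 * ‖x - xs‖ ^ 2 ≤ compositeObjective f lam P x)
    (hp : ∀ x, f p + lam / 2 * ‖p - P y‖ ^ 2 + (μ + lam) / 2 * ‖x - p‖ ^ 2 ≤
      f x + lam / 2 * ‖x - P y‖ ^ 2)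
    (hx' : f x' + lam / 2 * ‖x' - P y‖ ^ 2 ≤ f p + lam / 2 * ‖p - P y‖ ^ 2 +
      (s / 12 * r) ^ 2 * proxLyapunov f μ lam P xs x z)
    (hy : (1 + s) • y = x + s • z) (hz' : x' = (1 - s) • x + s • z') :
    proxLyapunov f μ lam P xs x' z' ≤
      ρ * Real.exp (3 / 5 * (s * r)) * proxLyapunov f μ lam P xs x z := by
  have hstep := accelerated_prox_step hs hs1 hμ hlam hρs (by linarith) hc hcond hP hPn
    (hgrow x) hp hx' hy hz'
  have hV := le_proxLyapunov z (hgrow x)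
  have hV' := le_proxLyapunov z' (hgrow x')
  have hx'p := hp x'
  change proxLyapunov f μ lam P xs x' z' ≤ ρ * proxLyapunov f μ lam P xs x z + _ + _ at hstep
  have hlampos : 0 < lam := by
    by_contra hneg
    nlinarith [mul_nonneg (neg_nonneg.2 (not_lt.1 hneg)) (sq_nonneg s)]
  have hgap := hgrow x
  have hgap' := hgrow x'
  have hX : 0 ≤ μ / 2 * ‖x - xs‖ ^ 2 := by positivity
  have hX' : 0 ≤ μ / 2 * ‖x' - xs‖ ^ 2 := by positivity
  have hZ : 0 ≤ μ / 2 * ‖z - xs‖ ^ 2 := by positivity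
  have hZ' : 0 ≤ μ / 2 * ‖z' - xs‖ ^ 2 := by positivity
  set V := proxLyapunov f μ lam P xs x z
  set V' := proxLyapunov f μ lam P xs x' z'
  have hVnn : 0 ≤ V := by linarith
  have hV'nn : 0 ≤ V' := by linarith
  obtain ⟨τ, hτ⟩ : ∃ τ, τ = s / 12 * r := ⟨_, rfl⟩
  rw [← hτ] at hx' hstep
  have hτ0 : 0 ≤ τ := by rw [hτ]; positivity
  have hτ1 : τ ≤ 1 / 12 := by rw [hτ]; nlinarith
  -- Strong convexity of the subproblem gives `(μ + lam)/2 * ‖x' - p‖² ≤ τ² V`, and `(μ + lam) s² ≤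
  -- 2μ` balances the weights, so the error is at most `√8 τ √(V V')`.
  have herr : (μ + lam) * s * (‖z' - xs‖ * ‖x' - p‖) ≤ 3 / 2 * τ * (V + V') := by
    refine le_of_sq_le_sq ?_ (by positivity)
    have h1 : (μ + lam) / 2 * ‖x' - p‖ ^ 2 ≤ τ ^ 2 * V := by linarith
    have h2 : μ / 2 * ‖z' - xs‖ ^ 2 ≤ V' := by linarith
    have h3 := mul_le_mul h1 h2 (by positivity) (by positivity)
    have h4 : (μ + lam) * s ^ 2 ≤ 2 * μ := by
      have : μ * s ^ 2 ≤ μ * 1 := mul_le_mul_of_nonneg_left (pow_le_one₀ hs.le hs1) hμ.le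
      linarith
    calc ((μ + lam) * s * (‖z' - xs‖ * ‖x' - p‖)) ^ 2
        = (μ + lam) * s ^ 2 * ((μ + lam) * (‖z' - xs‖ * ‖x' - p‖) ^ 2) := by ring
      _ ≤ 2 * μ * ((μ + lam) * (‖z' - xs‖ * ‖x' - p‖) ^ 2) :=
          mul_le_mul_of_nonneg_right h4 (by positivity)
      _ = 8 * ((μ + lam) / 2 * ‖x' - p‖ ^ 2 * (μ / 2 * ‖z' - xs‖ ^ 2)) := by ring
      _ ≤ 8 * (τ ^ 2 * V * V') := by linarith
      _ ≤ (3 / 2 * τ * (V + V')) ^ 2 := by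
          have h5 := mul_nonneg (sq_nonneg τ) (sq_nonneg (V - V'))
          have h6 := mul_nonneg (sq_nonneg τ) (mul_nonneg hVnn hV'nn)
          linarith
  have hexp : 3 / 5 * (s * r) = 36 / 5 * τ := by
    rw [hτ]
    ring
  rw [hexp]
  exact le_mul_exp_of_perturbed hVnn hV'nn hρ hτ0 hτ1 (by linarith)

end Lyapunov

/-! ### Admissible contraction factors -/

section Rates

/-- The conditions of the Lyapunov step hold for the contraction factor `1 - s`. -/
theorem lyapunov_conditions_one_sub {s : ℝ} (hs : 0 < s) (hs1 : s ≤ 3 / 5) :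
    2 / 5 ≤ 1 - s ∧ (1 - s) ^ 2 < 1 - s ∧
    2 * (1 - s - (1 - s) ^ 2) + (1 - s) * (s ^ 2 * (1 + s ^ 2) ^ 2) ≤
      2 * (1 - s - (1 - s) ^ 2) * (1 - s) * ((1 + 3 / 2 * s ^ 2) * (1 + s) ^ 2) := by
  refine ⟨by linarith, by nlinarith, ?_⟩
  -- This product is exactly the difference of the two sides. Its last factor is negative at `s =
  -- 1`, hence the restriction on `s`.
  have h : 0 ≤ s ^ 2 * (1 - s) * (1 + s - s ^ 2 - 3 * s ^ 3 - 4 * s ^ 4) := by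
    have h2 : s ^ 2 ≤ 9 / 25 := by nlinarith
    have h3 : s ^ 3 ≤ 27 / 125 := by nlinarith
    have h4 : s ^ 4 ≤ 81 / 625 := by nlinarith
    have h5 : s ^ 4 ≤ 27 / 125 * s := by nlinarith
    have h6 : s ^ 3 ≤ 9 / 25 * s := by nlinarith
    have h7 : s ^ 2 ≤ 3 / 5 * s := by nlinarith
    have : 0 ≤ 1 - s := by linarith
    have : 0 ≤ 1 + s - s ^ 2 - 3 * s ^ 3 - 4 * s ^ 4 := by linarith
    positivity
  linarith

/-- The conditions of the Lyapunov step hold for the contraction factor `1 - s / 2`. -/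
theorem lyapunov_conditions_one_sub_half {s : ℝ} (hs : 0 < s) (hs1 : s ≤ 1) :
    2 / 5 ≤ 1 - s / 2 ∧ (1 - s) ^ 2 < 1 - s / 2 ∧
    2 * (1 - s / 2 - (1 - s) ^ 2) + (1 - s / 2) * (s ^ 2 * (1 + s ^ 2) ^ 2) ≤
      2 * (1 - s / 2 - (1 - s) ^ 2) * (1 - s / 2) * ((1 + 3 / 2 * s ^ 2) * (1 + s) ^ 2) := by
  refine ⟨by linarith, by nlinarith, ?_⟩
  have h2 : s ^ 2 ≤ 1 := pow_le_one₀ hs.le hs1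
  have h3 : s ^ 3 ≤ s := pow_le_of_le_one hs.le hs1 (by norm_num)
  have h5 : s ^ 5 ≤ s ^ 3 := pow_le_pow_of_le_one hs.le hs1 (by norm_num)
  have h6 : (1 + s ^ 2) ^ 2 ≤ 4 := by nlinarith [sq_nonneg s]
  have h7 : (1 - s / 2) * (1 + s ^ 2) ^ 2 ≤ 4 - 2 * s := by nlinarith
  -- Here `ρ - (1 - s)² = s (3 - 2s) / 2`, so the right-hand side of the goal is `s (3 - 2s)` times
  -- the quantity bounded below.
  have h8 : 1 + 3 / 2 * s + 3 / 2 * s ^ 2 + s ^ 3 ≤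
      (1 - s / 2) * ((1 + 3 / 2 * s ^ 2) * (1 + s) ^ 2) := by nlinarith
  have h9 := mul_le_mul_of_nonneg_left h8 (by nlinarith : 0 ≤ s * (3 - 2 * s))
  have h10 : 0 ≤ s ^ 2 * (4 - 2 * s - (1 - s / 2) * (1 + s ^ 2) ^ 2) :=
    mul_nonneg (sq_nonneg s) (by linarith)
  have h11 : 0 ≤ s ^ 2 * (1 / 2 + 7 / 2 * s - 2 * s ^ 3) :=
    mul_nonneg (sq_nonneg s) (by linarith)
  linarith

end Rates

/-! ### The product space, the consensus projection and the exact step -/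

section Clients

variable {n d : ℕ}

/-- The space of all local models, with its Euclidean structure. -/
abbrev ClientSpace (n d : ℕ) := PiLp 2 (fun _ : Fin n => EuclideanSpace ℝ (Fin d))

theorem smul_clientMean (hn : 1 ≤ n) (x : Fin n → EuclideanSpace ℝ (Fin d)) :
    (n : ℝ) • clientMean x = ∑ i, x i := by
  have : (n : ℝ) ≠ 0 := by positivity
  rw [clientMean, smul_smul, mul_one_div_cancel this, one_smul]

theorem clientMean_const (hn : 1 ≤ n) (w : EuclideanSpace ℝ (Fin d)) :
    clientMean (fun _ : Fin n => w) = w := by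
  have : (n : ℝ) ≠ 0 := by positivity
  rw [clientMean, Finset.sum_const, Finset.card_univ, Fintype.card_fin,
    ← Nat.cast_smul_eq_nsmul ℝ, smul_smul, one_div_mul_cancel this, one_smul]

/-- Replacing every local model by the average. -/
noncomputable def meanProj (n d : ℕ) : ClientSpace n d →ₗ[ℝ] ClientSpace n d where
  toFun X := WithLp.toLp 2 fun _ => clientMean fun i => X i
  map_add' X Y := by
    ext1 i
    simp [clientMean, Finset.sum_add_distrib]
  map_smul' c X := by
    ext1 i
    simp [clientMean, ← Finset.smul_sum, smul_comm c]

@[simp]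
theorem meanProj_apply (X : ClientSpace n d) (i : Fin n) :
    meanProj n d X i = clientMean fun i => X i := rfl

theorem meanProj_idem (hn : 1 ≤ n) (X : ClientSpace n d) :
    meanProj n d (meanProj n d X) = meanProj n d X := by
  ext1 i
  simp [clientMean_const hn]

/-- The inner product of `X` with its projection and the squared norm of the projection are both `n`
times the squared norm of the mean, so the projection is orthogonal. -/
theorem norm_sq_eq_meanProj (hn : 1 ≤ n) (X : ClientSpace n d) :
    ‖X‖ ^ 2 = ‖meanProj n d X‖ ^ 2 + ‖X - meanProj n d X‖ ^ 2 := by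
  have h := smul_clientMean hn fun i => X i
  have h2 : inner ℝ (∑ i, X i) (clientMean fun i => X i) =
      n * ‖clientMean fun i => X i‖ ^ 2 := by
    rw [← h, real_inner_smul_left, real_inner_self_eq_norm_sq]
  have h3 : inner ℝ X (meanProj n d X) = n * ‖clientMean fun i => X i‖ ^ 2 := by
    rw [PiLp.inner_apply, ← h2, sum_inner]
    rfl
  have h4 : ‖meanProj n d X‖ ^ 2 = n * ‖clientMean fun i => X i‖ ^ 2 := by
    rw [PiLp.norm_sq_eq_of_L2]
    simp
  rw [norm_sub_sq_real X, h3, h4]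
  ring

theorem compositeObjective_eq (hn : 1 ≤ n) (f : Fin n → EuclideanSpace ℝ (Fin d) → ℝ) (lam : ℝ)
    (X : ClientSpace n d) :
    compositeObjective (fun X : ClientSpace n d => ∑ i, f i (X i)) lam (meanProj n d) X =
      n * fedObjective f lam fun i => X i := by
  have : (n : ℝ) ≠ 0 := by positivity
  simp only [compositeObjective, fedObjective, PiLp.norm_sq_eq_of_L2, PiLp.sub_apply,
    meanProj_apply]
  field_simp

variable {f : Fin n → EuclideanSpace ℝ (Fin d) → ℝ} {μ lam : ℝ}

theorem exists_compositeObjective_minimizer (hμ : 0 < μ) (hlam : 0 < lam)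
    (hd : ∀ i, Differentiable ℝ (f i)) (hf : ∀ i, IsStronglyConvexWith μ (f i)) :
    ∃ Xs : ClientSpace n d, ∀ X,
      compositeObjective (fun X : ClientSpace n d => ∑ i, f i (X i)) lam (meanProj n d) Xs ≤
        compositeObjective (fun X : ClientSpace n d => ∑ i, f i (X i)) lam (meanProj n d) X := by
  have : ProperSpace (ClientSpace n d) := FiniteDimensional.proper ℝ _
  choose c hc using fun i => (hf i).exists_const_add_le hμ
  have hcont : Continuous
      (compositeObjective (fun X : ClientSpace n d => ∑ i, f i (X i)) lam (meanProj n d)) := by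
    have h1 := fun i => (hd i).continuous
    have h2 : Continuous fun X : ClientSpace n d => meanProj n d X := by
      refine (PiLp.continuous_toLp 2 _).comp (continuous_pi fun _ => ?_)
      unfold clientMean
      fun_prop
    unfold compositeObjective
    fun_prop
  refine hcont.exists_forall_le (tendsto_atTop_of_quadratic_growth (c := ∑ i, c i)
    (by positivity : 0 < μ / 4) fun X => ?_)
  have h1 : ∑ i, (c i + μ / 4 * ‖X i‖ ^ 2) ≤ ∑ i, f i (X i) :=
    Finset.sum_le_sum fun i _ => hc i (X i)
  rw [Finset.sum_add_distrib, ← Finset.mul_sum, ← PiLp.norm_sq_eq_of_L2] at h1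
  have h2 : 0 ≤ lam / 2 * ‖X - meanProj n d X‖ ^ 2 := by positivity
  unfold compositeObjective
  linarith

theorem sum_proxObjective (lam : ℝ) (X Y : ClientSpace n d) :
    ∑ i, proxObjective (f i) lam (clientMean fun i => Y i) (X i) =
      ∑ i, f i (X i) + lam / 2 * ‖X - meanProj n d Y‖ ^ 2 := by
  simp only [proxObjective, Finset.sum_add_distrib, ← Finset.mul_sum, PiLp.norm_sq_eq_of_L2,
    PiLp.sub_apply, meanProj_apply]

/-- The exact proximal step of all clients, together with the accuracy of local accelerated
gradient descent relative to it. -/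
theorem exists_exact_step {L₁ : ℝ} (hμ : 0 < μ) (hμL : μ ≤ L₁) (hlam : 0 < lam)
    (hsm : ∀ i, IsSmoothWith L₁ (f i)) (hf : ∀ i, IsStronglyConvexWith μ (f i))
    (Y : ClientSpace n d) (T : ℕ) :
    ∃ p : ClientSpace n d,
      (∀ X : ClientSpace n d, ∑ i, f i (p i) + lam / 2 * ‖p - meanProj n d Y‖ ^ 2 +
        (μ + lam) / 2 * ‖X - p‖ ^ 2 ≤ ∑ i, f i (X i) + lam / 2 * ‖X - meanProj n d Y‖ ^ 2) ∧
      ∀ X : ClientSpace n d,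
        (∀ i, X i = (agdRun (proxObjective (f i) lam (clientMean fun i => Y i)) (L₁ + lam)
          (μ + lam) (Y i) T).iter) →
        ∑ i, f i (X i) + lam / 2 * ‖X - meanProj n d Y‖ ^ 2 ≤
          ∑ i, f i (p i) + lam / 2 * ‖p - meanProj n d Y‖ ^ 2 +
            Real.exp (-(√((μ + lam) / (L₁ + lam)) * T)) * ((L₁ + lam) * ‖Y - p‖ ^ 2) := by
  -- Once the average of `Y` is fixed, the subproblem separates over the clients.
  choose p hp0 hp using fun i => exists_proxObjective_minimizer hμ hlam.le (hsm i).1 (hf i)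
    (clientMean fun i => Y i)
  refine ⟨WithLp.toLp 2 p, fun X => ?_, fun X hX => ?_⟩
  · rw [← sum_proxObjective, ← sum_proxObjective, PiLp.norm_sq_eq_of_L2, Finset.mul_sum,
      ← Finset.sum_add_distrib]
    exact Finset.sum_le_sum fun i _ => hp i (X i)
  · rw [← sum_proxObjective, ← sum_proxObjective, PiLp.norm_sq_eq_of_L2, Finset.mul_sum,
      Finset.mul_sum, ← Finset.sum_add_distrib]
    refine Finset.sum_le_sum fun i _ => ?_
    have h := agdRun_gap_le (by linarith) (by linarith : μ + lam ≤ L₁ + lam)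
      (isStronglyConvexWith_proxObjective (hsm i).1 (hf i) _)
      (proxObjective_le_quadratic (hsm i) _) (hp0 i) (Y i) T
    rw [← hX i] at h
    simp only [PiLp.sub_apply]
    linarith

end Clients

/-! ### Accuracy reached by the prescribed local steps -/

section InnerAccuracy

variable {L₁ μ lam : ℝ}

theorem innerSteps_eq (hμ : 0 < μ) (hlam : 0 < lam) (n k : ℕ) :
    innerSteps n L₁ μ lam k = √((L₁ + lam) / (μ + lam)) *
      (Real.log (1152 * L₁ * lam * (n : ℝ) ^ 2 * (2 * √(lam / μ) + 1) ^ 2 / μ ^ 2) +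
        4 * √(μ / lam) * k) := by
  have h : √(μ * (L₁ + lam) / (lam * (μ + lam))) =
      √(μ / lam) * √((L₁ + lam) / (μ + lam)) := by
    rw [← Real.sqrt_mul (by positivity)]
    congr 1
    field_simp
  rw [innerSteps, h]
  ring

/-- The prescribed number of local steps reaches the relative accuracy that the outer loop needs. -/
theorem innerSteps_accuracy {n : ℕ} (hn : 1 ≤ n) (hμ : 0 < μ) (hμL : μ ≤ L₁) (hμlam : μ ≤ lam)
    (k : ℕ) :
    Real.exp (-(√((μ + lam) / (L₁ + lam)) * (⌈innerSteps n L₁ μ lam k⌉₊ : ℕ))) *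
        ((L₁ + lam) * (16 / μ)) ≤
      (√(μ / lam) / 12 * (1 / (1 + 2 * √(μ / lam))) ^ k) ^ 2 := by
  have hL : 0 < L₁ := hμ.trans_le hμL
  have hlam : 0 < lam := hμ.trans_le hμlam
  have hn' : (1 : ℝ) ≤ n := by exact_mod_cast hn
  have hinv : √((μ + lam) / (L₁ + lam)) * √((L₁ + lam) / (μ + lam)) = 1 := by
    rw [← Real.sqrt_mul (by positivity), div_mul_div_comm, mul_comm (L₁ + lam),
      div_self (by positivity), Real.sqrt_one]
  have hs : 0 < √(μ / lam) := Real.sqrt_pos.2 (by positivity)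
  have hsinv : √(lam / μ) = 1 / √(μ / lam) := by
    rw [← inv_div μ lam, Real.sqrt_inv, one_div]
  have hs2 : lam * √(μ / lam) ^ 2 = μ := by
    rw [Real.sq_sqrt (by positivity)]
    field_simp
  have hceil := mul_le_mul_of_nonneg_left (Nat.le_ceil (innerSteps n L₁ μ lam k))
    (Real.sqrt_nonneg ((μ + lam) / (L₁ + lam)))
  nth_rewrite 1 [innerSteps_eq hμ hlam] at hceil
  rw [← mul_assoc, hinv, one_mul, hsinv] at hceil
  set s := √(μ / lam)
  set B := 1152 * L₁ * lam * (n : ℝ) ^ 2 * (2 * (1 / s) + 1) ^ 2 / μ ^ 2 with hB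
  have hBpos : 0 < B := by positivity
  -- The growing part of `T_k` yields `exp (-4sk) = (exp (-2s))^(2k)`, and `exp (2s) ≥ 1 + 2s`.
  have h1 : Real.exp (-(√((μ + lam) / (L₁ + lam)) * (⌈innerSteps n L₁ μ lam k⌉₊ : ℕ))) ≤
      B⁻¹ * ((1 / (1 + 2 * s)) ^ k) ^ 2 := by
    calc _ ≤ Real.exp (-(Real.log B + 4 * s * k)) := Real.exp_le_exp.2 (neg_le_neg hceil)
      _ = B⁻¹ * (Real.exp (-(2 * s)) ^ k) ^ 2 := by
        rw [neg_add, Real.exp_add, Real.exp_neg, Real.exp_log hBpos, ← Real.exp_nat_mul,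
          ← Real.exp_nat_mul]
        congr 2
        push_cast
        ring
      _ ≤ _ := by
        have : Real.exp (-(2 * s)) ≤ 1 / (1 + 2 * s) := by
          rw [Real.exp_neg, ← one_div]
          exact one_div_le_one_div_of_le (by positivity) (by
            linarith [Real.add_one_le_exp (2 * s)])
        gcongr
  -- `1152 = 8 * 12²` cancels the tolerance constant. The rest is `(2 + s)² ≥ 4` and `(L₁ + lam) μ ≤
  -- 2 L₁ lam`.
  have h2 : B⁻¹ * ((L₁ + lam) * (16 / μ)) ≤ (s / 12) ^ 2 := by
    have h3 : (L₁ + lam) * μ ≤ 2 * (L₁ * lam) := by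
      nlinarith [mul_le_mul_of_nonneg_left hμlam hL.le, mul_le_mul_of_nonneg_right hμL hlam.le]
    have h4 : (1 : ℝ) ≤ n ^ 2 := one_le_pow₀ hn'
    have h5 : (4 : ℝ) ≤ (2 + s) ^ 2 := by nlinarith
    have h6 : (L₁ * lam) * (1 * 4) ≤ (L₁ * lam) * (n ^ 2 * (2 + s) ^ 2) :=
      mul_le_mul_of_nonneg_left (mul_le_mul h4 h5 (by norm_num) (by positivity)) (by positivity)
    rw [inv_mul_le_iff₀ hBpos]
    have h7 : B * (s / 12) ^ 2 = 8 * ((L₁ * lam) * (n ^ 2 * (2 + s) ^ 2)) / μ ^ 2 := by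
      rw [hB]
      field_simp
      ring
    have h8 : (L₁ + lam) * (16 / μ) = 16 * ((L₁ + lam) * μ) / μ ^ 2 := by
      field_simp
    rw [h7, h8]
    exact div_le_div_of_nonneg_right (by linarith) (by positivity)
  have hnn : 0 ≤ (L₁ + lam) * (16 / μ) := by positivity
  have hq : 0 ≤ ((1 / (1 + 2 * s)) ^ k) ^ 2 := by positivity
  have h9 := mul_le_mul_of_nonneg_right h1 hnn
  have h10 := mul_le_mul_of_nonneg_right h2 hq
  rw [mul_pow]
  linarith

end InnerAccuracy

/-! ### Decay of the objective gap along the iterations -/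

section Trajectory

variable {n d : ℕ} {f : Fin n → EuclideanSpace ℝ (Fin d) → ℝ} {L₁ μ lam : ℝ}

/-- The Lyapunov function decays geometrically along the method, up to a bounded factor. -/
theorem iapgd_lyapunov_le (hn : 1 ≤ n) (hμ : 0 < μ) (hμL : μ ≤ L₁) (hμlam : μ ≤ lam)
    (hsm : ∀ i, IsSmoothWith L₁ (f i)) (hf : ∀ i, IsStronglyConvexWith μ (f i)) {s ρ : ℝ}
    (hs : s = √(μ / lam)) (hρs : 1 - s ≤ ρ) (hρ : 2 / 5 ≤ ρ) (hc : (1 - s) ^ 2 < ρ)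
    (hcond : 2 * (ρ - (1 - s) ^ 2) + ρ * (s ^ 2 * (1 + s ^ 2) ^ 2) ≤
      2 * (ρ - (1 - s) ^ 2) * ρ * ((1 + 3 / 2 * s ^ 2) * (1 + s) ^ 2))
    {Xs : ClientSpace n d}
    (hXs : ∀ X,
      compositeObjective (fun X : ClientSpace n d => ∑ i, f i (X i)) lam (meanProj n d) Xs ≤
        compositeObjective (fun X : ClientSpace n d => ∑ i, f i (X i)) lam (meanProj n d) X)
    (hgrow : ∀ X,
      compositeObjective (fun X : ClientSpace n d => ∑ i, f i (X i)) lam (meanProj n d) Xs +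
          μ / 2 * ‖X - Xs‖ ^ 2 ≤
        compositeObjective (fun X : ClientSpace n d => ∑ i, f i (X i)) lam (meanProj n d) X)
    (x₀ : Fin n → EuclideanSpace ℝ (Fin d)) (k : ℕ) :
    ∃ Z : ClientSpace n d,
      (1 + s) • WithLp.toLp 2 (iapgd f L₁ μ lam x₀ k).y =
        WithLp.toLp 2 (iapgd f L₁ μ lam x₀ k).x + s • Z ∧
      proxLyapunov (fun X : ClientSpace n d => ∑ i, f i (X i)) μ lam (meanProj n d) Xs
          (WithLp.toLp 2 (iapgd f L₁ μ lam x₀ k).x) Z ≤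
        ρ ^ k * Real.exp (3 / 5 * ((1 + 2 * s) / 2 * (1 - (1 / (1 + 2 * s)) ^ k))) *
          proxLyapunov (fun X : ClientSpace n d => ∑ i, f i (X i)) μ lam (meanProj n d) Xs
            (WithLp.toLp 2 x₀) (WithLp.toLp 2 x₀) := by
  have hlam : 0 < lam := hμ.trans_le hμlam
  have hs0 : 0 < s := by rw [hs]; exact Real.sqrt_pos.2 (by positivity)
  have hs1 : s ≤ 1 := by
    rw [hs]
    exact Real.sqrt_le_one.2 ((div_le_one hlam).2 hμlam)
  have hs2 : lam * s ^ 2 = μ := by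
    rw [hs, Real.sq_sqrt (by positivity)]
    field_simp
  have hmom : (√lam - √μ) / (√lam + √μ) = (1 - s) / (1 + s) := by
    have h1 : 0 < √lam := Real.sqrt_pos.2 hlam
    have h2 : √μ = s * √lam := by
      rw [hs, ← Real.sqrt_mul (by positivity), div_mul_cancel₀ _ hlam.ne']
    rw [h2, div_eq_div_iff (by positivity) (by positivity)]
    ring
  induction k with
  | zero => exact ⟨WithLp.toLp 2 x₀, by simp [iapgd, add_smul], by simp [iapgd]⟩
  | succ k ih =>
    obtain ⟨Z, hy, hV⟩ := ih
    set S := iapgd f L₁ μ lam x₀ k with hS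
    set S' := iapgd f L₁ μ lam x₀ (k + 1) with hS'
    have hstep : S' = iapgdStep f L₁ μ lam k S := rfl
    obtain ⟨p, hp, hacc⟩ := exists_exact_step hμ hμL hlam hsm hf (WithLp.toLp 2 S.y)
      ⌈innerSteps n L₁ μ lam k⌉₊
    have hx' := hacc (WithLp.toLp 2 S'.x) fun i => rfl
    have hdist := norm_sub_prox_sq_le_proxLyapunov (f := fun X : ClientSpace n d => ∑ i, f i (X i))
      hμ hlam (meanProj_idem hn) (norm_sq_eq_meanProj hn) hs0 hXs (hgrow _) hp hy
    have hinner := innerSteps_accuracy hn hμ hμL hμlam k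
    rw [← hs] at hinner
    have hVnn : 0 ≤ proxLyapunov (fun X : ClientSpace n d => ∑ i, f i (X i)) μ lam
        (meanProj n d) Xs (WithLp.toLp 2 S.x) Z := by
      have h1 := le_proxLyapunov Z (hgrow (WithLp.toLp 2 S.x))
      have h2 := hXs (WithLp.toLp 2 S.x)
      have h3 : 0 ≤ μ / 2 * ‖Z - Xs‖ ^ 2 := by positivity
      linarith
    set q := 1 / (1 + 2 * s) with hq
    have hq0 : 0 ≤ q := by positivity
    have hq1 : q ≤ 1 := by
      rw [hq, div_le_one (by positivity)]
      linarith
    set V := proxLyapunov (fun X : ClientSpace n d => ∑ i, f i (X i)) μ lam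
        (meanProj n d) Xs (WithLp.toLp 2 S.x) Z
    have herr : Real.exp (-(√((μ + lam) / (L₁ + lam)) * (⌈innerSteps n L₁ μ lam k⌉₊ : ℕ))) *
        ((L₁ + lam) * ‖WithLp.toLp 2 S.y - p‖ ^ 2) ≤ (s / 12 * q ^ k) ^ 2 * V := by
      have hnn : 0 ≤ Real.exp (-(√((μ + lam) / (L₁ + lam)) *
          (⌈innerSteps n L₁ μ lam k⌉₊ : ℕ))) * (L₁ + lam) :=
        mul_nonneg (Real.exp_pos _).le (by linarith)
      have h1 := mul_le_mul_of_nonneg_left hdist hnn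
      have h2 := mul_le_mul_of_nonneg_right hinner hVnn
      linarith
    refine ⟨WithLp.toLp 2 S.x + (1 / s) • (WithLp.toLp 2 S'.x - WithLp.toLp 2 S.x), ?_, ?_⟩
    · have hy' : WithLp.toLp 2 S'.y = WithLp.toLp 2 S'.x +
          ((1 - s) / (1 + s)) • (WithLp.toLp 2 S'.x - WithLp.toLp 2 S.x) := by
        rw [← hmom]
        rfl
      rw [hy']
      match_scalars <;> field_simp <;> ring
    · have hcontr := proxLyapunov_step (r := q ^ k)
        (z' := WithLp.toLp 2 S.x + (1 / s) • (WithLp.toLp 2 S'.x - WithLp.toLp 2 S.x))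
        hs0 hs1 hμ hs2 (pow_nonneg hq0 k) (pow_le_one₀ hq0 hq1) hρs hρ hc hcond
        (meanProj_idem hn) (norm_sq_eq_meanProj hn) hgrow hp
        (hx'.trans (by linarith)) hy (by (match_scalars <;> field_simp); ring)
      refine hcontr.trans ((mul_le_mul_of_nonneg_left hV
        (mul_nonneg (by linarith) (Real.exp_pos _).le)).trans (le_of_eq ?_))
      -- `(1 + 2s)/2 * (1 - q^k)` is the geometric sum of `s * q^j` over `j < k`, because `s / (1 -
      -- q) = (1 + 2s)/2`.
      have hexp : 3 / 5 * ((1 + 2 * s) / 2 * (1 - q ^ (k + 1))) =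
          3 / 5 * (s * q ^ k) + 3 / 5 * ((1 + 2 * s) / 2 * (1 - q ^ k)) := by
        have : q * (1 + 2 * s) = 1 := by rw [hq]; field_simp
        have h2 : q ^ (k + 1) * (1 + 2 * s) = q ^ k := by rw [pow_succ, mul_assoc, this, mul_one]
        linear_combination (-3 / 10) * h2
      rw [hexp, Real.exp_add]
      ring

theorem exp_nine_tenths_le : Real.exp (9 / 10) ≤ 8 / 3 := by
  have h1 := Real.exp_one_lt_d9
  have h2 := Real.add_one_le_exp (1 / 10 : ℝ)
  have h3 : Real.exp (9 / 10) * Real.exp (1 / 10) = Real.exp 1 := by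
    rw [← Real.exp_add]
    norm_num
  nlinarith [Real.exp_pos (9 / 10)]

/-- Geometric decay of the objective gap for every admissible contraction factor. -/
theorem iapgd_gap_le (hn : 1 ≤ n) (hμ : 0 < μ) (hμL : μ ≤ L₁) (hμlam : μ ≤ lam)
    (hsm : ∀ i, IsSmoothWith L₁ (f i)) (hf : ∀ i, IsStronglyConvexWith μ (f i)) {s ρ : ℝ}
    (hs : s = √(μ / lam)) (hρs : 1 - s ≤ ρ) (hρ : 2 / 5 ≤ ρ) (hc : (1 - s) ^ 2 < ρ)
    (hcond : 2 * (ρ - (1 - s) ^ 2) + ρ * (s ^ 2 * (1 + s ^ 2) ^ 2) ≤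
      2 * (ρ - (1 - s) ^ 2) * ρ * ((1 + 3 / 2 * s ^ 2) * (1 + s) ^ 2))
    {xs : Fin n → EuclideanSpace ℝ (Fin d)}
    (hxs : ∀ x, fedObjective f lam xs ≤ fedObjective f lam x)
    (x₀ : Fin n → EuclideanSpace ℝ (Fin d)) (k : ℕ) :
    fedObjective f lam (iapgd f L₁ μ lam x₀ k).x - fedObjective f lam xs ≤
      8 * ρ ^ k * (fedObjective f lam x₀ - fedObjective f lam xs) := by
  have hlam : 0 < lam := hμ.trans_le hμlam
  have hn' : (0 : ℝ) < n := by exact_mod_cast hn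
  have hXs : ∀ X,
      compositeObjective (fun X : ClientSpace n d => ∑ i, f i (X i)) lam (meanProj n d)
        (WithLp.toLp 2 xs) ≤
      compositeObjective (fun X : ClientSpace n d => ∑ i, f i (X i)) lam (meanProj n d) X :=
    fun X => by
      rw [compositeObjective_eq hn, compositeObjective_eq hn]
      exact mul_le_mul_of_nonneg_left (hxs _) hn'.le
  -- Only the characterization of the exact step is needed, so the number `0` of inner steps is
  -- arbitrary.
  have hgrow := compositeObjective_growth hμ hlam (meanProj_idem hn) (norm_sq_eq_meanProj hn) hXs
    (exists_exact_step hμ hμL hlam hsm hf (WithLp.toLp 2 xs) 0).choose_spec.1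
  obtain ⟨Z, -, hV⟩ := iapgd_lyapunov_le hn hμ hμL hμlam hsm hf hs hρs hρ hc hcond hXs hgrow x₀ k
  have h1 := le_proxLyapunov Z (hgrow (WithLp.toLp 2 (iapgd f L₁ μ lam x₀ k).x))
  have h2 := proxLyapunov_self_le (hgrow (WithLp.toLp 2 x₀))
  have h3 : 0 ≤ μ / 2 * ‖Z - WithLp.toLp 2 xs‖ ^ 2 := by positivity
  have hs0 : 0 ≤ s := by rw [hs]; exact Real.sqrt_nonneg _
  have hs1 : s ≤ 1 := by
    rw [hs]
    exact Real.sqrt_le_one.2 ((div_le_one hlam).2 hμlam)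
  have h4 : Real.exp (3 / 5 * ((1 + 2 * s) / 2 * (1 - (1 / (1 + 2 * s)) ^ k))) ≤ 8 / 3 := by
    refine (Real.exp_le_exp.2 ?_).trans exp_nine_tenths_le
    have : 0 ≤ (1 + 2 * s) / 2 * (1 / (1 + 2 * s)) ^ k := by positivity
    linarith
  have h5 : 0 ≤ ρ ^ k := pow_nonneg (by linarith) k
  simp only [compositeObjective_eq hn] at h1 h2
  have h6 := sub_nonneg.2 (mul_le_mul_of_nonneg_left (hxs x₀) hn'.le)
  have h7 := mul_le_mul_of_nonneg_left h4 h5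
  have h8 := mul_le_mul_of_nonneg_left h2
    (mul_nonneg h5 (Real.exp_pos (3 / 5 * ((1 + 2 * s) / 2 * (1 - (1 / (1 + 2 * s)) ^ k)))).le)
  have h9 := mul_le_mul_of_nonneg_right h7 (mul_nonneg (by norm_num : (0 : ℝ) ≤ 3 / 2) h6)
  -- The constant is `8 = 2 * (8/3) * (3/2)`: half of the gap is below `V`, the accumulated loss is
  -- at most `8/3`, and initially `V` is at most `3/2` of the gap.
  refine le_of_mul_le_mul_left ?_ hn'
  linarith

end Trajectory

/-! ### Communication and gradient counts -/

section Complexity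

variable {n d : ℕ} {f : Fin n → EuclideanSpace ℝ (Fin d) → ℝ} {L₁ μ lam : ℝ}

theorem iapgd_comms (x₀ : Fin n → EuclideanSpace ℝ (Fin d)) (k : ℕ) :
    (iapgd f L₁ μ lam x₀ k).comms = k := by
  induction k with
  | zero => rfl
  | succ k ih => rw [iapgd, iapgdStep, ih]

theorem iapgd_grads (x₀ : Fin n → EuclideanSpace ℝ (Fin d)) (k : ℕ) (i : Fin n) :
    (iapgd f L₁ μ lam x₀ k).grads i =
      ∑ j ∈ Finset.range k, ⌈innerSteps n L₁ μ lam j⌉₊ := by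
  induction k with
  | zero => rfl
  | succ k ih => rw [iapgd, Finset.sum_range_succ, ← ih]; simp only [iapgdStep, agdRun_grads]

/-- The logarithmic constant in the number of local steps. -/
theorem log_innerSteps_le (hn : 1 ≤ n) (hμ : 0 < μ) (hμL : μ ≤ L₁) (hμlam : μ ≤ lam) {ℓ : ℝ}
    (hℓ : Real.log 2 ≤ ℓ) :
    0 ≤ Real.log (L₁ * lam * (n : ℝ) / μ ^ 2) ∧
    0 ≤ Real.log (1152 * L₁ * lam * (n : ℝ) ^ 2 * (2 * √(lam / μ) + 1) ^ 2 / μ ^ 2) ∧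
    Real.log (1152 * L₁ * lam * (n : ℝ) ^ 2 * (2 * √(lam / μ) + 1) ^ 2 / μ ^ 2) ≤
      14 * ℓ + 2 * Real.log (L₁ * lam * (n : ℝ) / μ ^ 2) := by
  have hL : 0 < L₁ := hμ.trans_le hμL
  have hlam : 0 < lam := hμ.trans_le hμlam
  have hn' : (1 : ℝ) ≤ n := by exact_mod_cast hn
  have hw : 1 ≤ √(lam / μ) := Real.one_le_sqrt.2 ((one_le_div hμ).2 hμlam)
  have hw2 : √(lam / μ) ^ 2 = lam / μ := Real.sq_sqrt (by positivity)
  set w := √(lam / μ)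
  have h1 : 1 ≤ L₁ / μ := (one_le_div hμ).2 hμL
  have h2 : 1 ≤ lam / μ := (one_le_div hμ).2 hμlam
  have hA : L₁ * lam * (n : ℝ) / μ ^ 2 = L₁ / μ * (lam / μ) * n := by
    field_simp
  have hB : 1152 * L₁ * lam * (n : ℝ) ^ 2 * (2 * w + 1) ^ 2 / μ ^ 2 =
      1152 * (L₁ / μ * (lam / μ)) * n ^ 2 * (2 * w + 1) ^ 2 := by
    field_simp
  rw [hA, hB]
  set a := L₁ / μ
  set b := lam / μ
  have hab : 1 ≤ a * b := one_le_mul_of_one_le_of_one_le h1 h2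
  have hn2 : (1 : ℝ) ≤ n ^ 2 := one_le_pow₀ hn'
  have hAge : 1 ≤ a * b * n := one_le_mul_of_one_le_of_one_le hab hn'
  refine ⟨Real.log_nonneg hAge, Real.log_nonneg ?_, ?_⟩
  · have h3 : (1 : ℝ) ≤ (2 * w + 1) ^ 2 := one_le_pow₀ (by linarith)
    exact one_le_mul_of_one_le_of_one_le
      (one_le_mul_of_one_le_of_one_le (by linarith) hn2) h3
  · have h3 : (2 * w + 1) ^ 2 ≤ 9 * b := by
      rw [← hw2]
      nlinarith
    -- `1152 * 9 = 10368 ≤ 2^14`; one extra factor `a ≥ 1` completes the square of `a * b * n`.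
    have h4 : 1152 * (a * b) * n ^ 2 * (2 * w + 1) ^ 2 ≤ 2 ^ 14 * (a * b * n) ^ 2 := by
      calc 1152 * (a * b) * n ^ 2 * (2 * w + 1) ^ 2
          ≤ 1152 * (a * b) * n ^ 2 * (9 * b) := by gcongr
        _ = 10368 * (1 * (a * b ^ 2 * n ^ 2)) := by ring
        _ ≤ 10368 * (a * (a * b ^ 2 * n ^ 2)) := by gcongr
        _ = 10368 * (a * b * n) ^ 2 := by ring
        _ ≤ 2 ^ 14 * (a * b * n) ^ 2 :=
            mul_le_mul_of_nonneg_right (by norm_num) (sq_nonneg _)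
    refine (Real.log_le_log (by positivity) h4).trans ?_
    rw [Real.log_mul (by positivity) (by positivity), Real.log_pow, Real.log_pow]
    push_cast
    linarith

/-- Total number of local steps in `K` rounds. -/
theorem sum_ceil_innerSteps_le (hn : 1 ≤ n) (hμ : 0 < μ) (hμL : μ ≤ L₁) (hμlam : μ ≤ lam)
    {ℓ : ℝ} (hℓ : Real.log 2 ≤ ℓ) {K : ℕ} (hK : (K : ℝ) ≤ 10 * √(lam / μ) * ℓ) :
    ((∑ j ∈ Finset.range K, ⌈innerSteps n L₁ μ lam j⌉₊ : ℕ) : ℝ) ≤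
      560 * √((L₁ + lam) / μ) * ℓ * (Real.log (L₁ * lam * (n : ℝ) / μ ^ 2) + ℓ) := by
  have hL : 0 < L₁ := hμ.trans_le hμL
  have hlam : 0 < lam := hμ.trans_le hμlam
  obtain ⟨hΛ, hA, hAle⟩ := log_innerSteps_le hn hμ hμL hμlam hℓ
  have hℓ0 : 1 / 2 ≤ ℓ := by linarith [Real.log_two_gt_d9]
  have hκ : 1 ≤ √((L₁ + lam) / (μ + lam)) :=
    Real.one_le_sqrt.2 ((one_le_div (by linarith)).2 (by linarith))
  have hinner : ∀ j : ℕ, innerSteps n L₁ μ lam j = _ := fun j => innerSteps_eq hμ hlam n j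
  have hws : √(μ / lam) * √(lam / μ) = 1 := by
    rw [← Real.sqrt_mul (by positivity), div_mul_div_comm, mul_comm lam,
      div_self (by positivity), Real.sqrt_one]
  have hκw : √((L₁ + lam) / (μ + lam)) * √(lam / μ) ≤ √((L₁ + lam) / μ) := by
    rw [← Real.sqrt_mul (by positivity)]
    refine Real.sqrt_le_sqrt ?_
    rw [div_mul_div_comm, div_le_div_iff₀ (by positivity) hμ]
    have : 0 ≤ (L₁ + lam) * μ * μ := by positivity
    linarith
  set A := Real.log (1152 * L₁ * lam * (n : ℝ) ^ 2 * (2 * √(lam / μ) + 1) ^ 2 / μ ^ 2)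
  set Λ := Real.log (L₁ * lam * (n : ℝ) / μ ^ 2)
  set κ := √((L₁ + lam) / (μ + lam))
  set w := √(lam / μ)
  set s := √(μ / lam)
  have hs0 : 0 ≤ s := Real.sqrt_nonneg _
  have hw0 : 0 ≤ w := Real.sqrt_nonneg _
  -- Since `s * j ≤ 10ℓ`, the growing part adds `40ℓ` to `14ℓ + 2Λ`, and rounding up costs at most
  -- `2κℓ`; this gives `56`.
  have hterm : ∀ j ∈ Finset.range K,
      (⌈innerSteps n L₁ μ lam j⌉₊ : ℝ) ≤ 56 * κ * (Λ + ℓ) := fun j hj => by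
    have hjK : (j : ℝ) ≤ 10 * w * ℓ :=
      (by exact_mod_cast (Finset.mem_range.1 hj).le : (j : ℝ) ≤ K).trans hK
    have hsj : s * j ≤ 10 * ℓ := by
      calc s * j ≤ s * (10 * w * ℓ) := mul_le_mul_of_nonneg_left hjK hs0
        _ = 10 * ℓ * (s * w) := by ring
        _ = 10 * ℓ := by rw [hws, mul_one]
    have hnn : 0 ≤ κ * (A + 4 * s * j) := by positivity
    rw [hinner]
    refine (Nat.ceil_lt_add_one hnn).le.trans ?_
    have h1 : A + 4 * s * j ≤ 54 * ℓ + 2 * Λ := by linarith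
    have h2 := mul_le_mul_of_nonneg_left h1 (by linarith : 0 ≤ κ)
    have h3 : 1 ≤ κ * (2 * ℓ) := one_le_mul_of_one_le_of_one_le hκ (by linarith)
    have h4 : 0 ≤ κ * Λ := by positivity
    linarith
  push_cast
  refine (Finset.sum_le_card_nsmul _ _ _ hterm).trans ?_
  rw [Finset.card_range, nsmul_eq_mul]
  have h5 : 0 ≤ Λ + ℓ := by linarith
  calc (K : ℝ) * (56 * κ * (Λ + ℓ)) ≤ 10 * w * ℓ * (56 * κ * (Λ + ℓ)) :=
        mul_le_mul_of_nonneg_right hK (by positivity)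
    _ = κ * w * (560 * (ℓ * (Λ + ℓ))) := by ring
    _ ≤ √((L₁ + lam) / μ) * (560 * (ℓ * (Λ + ℓ))) :=
        mul_le_mul_of_nonneg_right hκw (by positivity)
    _ = _ := by ring

/-- Number of iterations that a geometric rate needs to reach accuracy `ε`. -/
theorem exists_iterations {s M ε : ℝ} (hs : 0 < s) (hs1 : s ≤ 1) (hε : 0 < ε) (hM : ε ≤ M / 2) :
    ∃ K : ℕ, (∀ k : ℕ, K ≤ k → 8 * (1 - s / 2) ^ k * M ≤ ε) ∧
      (K : ℝ) ≤ 10 * (1 / s) * Real.log (M / ε) := by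
  have hMpos : 0 < M := by linarith
  have hℓ : Real.log 2 ≤ Real.log (M / ε) :=
    Real.log_le_log two_pos ((le_div_iff₀ hε).2 (by linarith))
  have hlog : Real.log (8 * (M / ε)) = 3 * Real.log 2 + Real.log (M / ε) := by
    rw [Real.log_mul (by norm_num) (by positivity), show (8 : ℝ) = 2 ^ 3 by norm_num,
      Real.log_pow]
    push_cast
    ring
  have hℓ2 := Real.log_two_gt_d9
  -- As `ℓ = log (M/ε)` is at least `log 2 > 1/2`, `log (8M/ε) ≤ 4ℓ` and rounding costs at most
  -- `2ℓ/s`; hence `8 + 2 = 10`.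
  refine ⟨⌈2 / s * Real.log (8 * (M / ε))⌉₊, fun k hk => ?_, ?_⟩
  · have h1 : 2 / s * Real.log (8 * (M / ε)) ≤ k := (Nat.le_ceil _).trans (by exact_mod_cast hk)
    have h2 : Real.log (8 * (M / ε)) ≤ k * (s / 2) := by
      have := mul_le_mul_of_nonneg_right h1 (by positivity : 0 ≤ s / 2)
      calc Real.log (8 * (M / ε)) = 2 / s * Real.log (8 * (M / ε)) * (s / 2) := by field_simp
        _ ≤ _ := this
    have h3 : (1 - s / 2) ^ k ≤ (8 * (M / ε))⁻¹ := by
      calc (1 - s / 2) ^ k ≤ Real.exp (-(s / 2)) ^ k :=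
            pow_le_pow_left₀ (by linarith) (Real.one_sub_le_exp_neg _) _
        _ = Real.exp (-(k * (s / 2))) := by
            rw [← Real.exp_nat_mul]
            congr 1
            ring
        _ ≤ Real.exp (-Real.log (8 * (M / ε))) := Real.exp_le_exp.2 (neg_le_neg h2)
        _ = (8 * (M / ε))⁻¹ := by rw [Real.exp_neg, Real.exp_log (by positivity)]
    calc 8 * (1 - s / 2) ^ k * M ≤ 8 * (8 * (M / ε))⁻¹ * M := by gcongr
      _ = ε := by field_simp
  · have hs' : 1 ≤ 1 / s := (one_le_div hs).2 hs1
    have hnn : 0 ≤ 2 / s * Real.log (8 * (M / ε)) := by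
      rw [hlog]
      exact mul_nonneg (by positivity) (by linarith)
    refine (Nat.ceil_lt_add_one hnn).le.trans ?_
    have h1 : 2 / s * Real.log (8 * (M / ε)) ≤ 1 / s * (8 * Real.log (M / ε)) := by
      rw [hlog, show 2 / s = 1 / s * 2 by ring, mul_assoc]
      exact mul_le_mul_of_nonneg_left (by linarith) (by positivity)
    have h2 : 1 ≤ 1 / s * (2 * Real.log (M / ε)) :=
      one_le_mul_of_one_le_of_one_le hs' (by linarith)
    linarith

end Complexity

theorem mainTheorem9 :
    ∃ C : ℝ, 0 < C ∧
      ∀ (n d : ℕ) (f : Fin n → EuclideanSpace ℝ (Fin d) → ℝ) (L₁ μ lam : ℝ)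
        (x₀ : Fin n → EuclideanSpace ℝ (Fin d)),
        1 ≤ n → 0 < μ → μ ≤ L₁ → μ ≤ lam →
        (∀ i, IsSmoothWith L₁ (f i)) → (∀ i, IsStronglyConvexWith μ (f i)) →
        ∃ xs : Fin n → EuclideanSpace ℝ (Fin d),
          (∀ x, fedObjective f lam xs ≤ fedObjective f lam x) ∧
          -- the linear rate
          (3 * μ ≤ lam → ∀ k : ℕ,
            fedObjective f lam (iapgd f L₁ μ lam x₀ k).x - fedObjective f lam xs ≤
              8 * (1 - √(μ / lam)) ^ k *
                (fedObjective f lam x₀ - fedObjective f lam xs)) ∧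
          -- the communication and local gradient complexities
          (∀ M ε : ℝ, fedObjective f lam x₀ - fedObjective f lam xs ≤ M →
            0 < ε → ε ≤ M / 2 →
            ∃ K : ℕ,
              (∀ k : ℕ, K ≤ k →
                fedObjective f lam (iapgd f L₁ μ lam x₀ k).x - fedObjective f lam xs ≤ ε) ∧
              ((iapgd f L₁ μ lam x₀ K).comms : ℝ) ≤ C * √(lam / μ) * Real.log (M / ε) ∧
              ∀ i : Fin n, ((iapgd f L₁ μ lam x₀ K).grads i : ℝ) ≤
                C * √((L₁ + lam) / μ) * Real.log (M / ε) *
                  (Real.log (L₁ * lam * (n : ℝ) / μ ^ 2) + Real.log (M / ε))) := by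
  -- `560 = 10 * 56` comes from the gradient count; communications need only `10`.
  refine ⟨560, by norm_num, fun n d f L₁ μ lam x₀ hn hμ hμL hμlam hsm hf => ?_⟩
  have hlam : 0 < lam := hμ.trans_le hμlam
  have hn' : (0 : ℝ) < n := by exact_mod_cast hn
  obtain ⟨Xs, hXs⟩ := exists_compositeObjective_minimizer hμ hlam (fun i => (hsm i).1) hf
  have hxs : ∀ x, fedObjective f lam (fun i => Xs i) ≤ fedObjective f lam x := fun x => by
    have h := hXs (WithLp.toLp 2 x)
    rw [compositeObjective_eq hn, compositeObjective_eq hn] at h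
    exact le_of_mul_le_mul_left h hn'
  have hs0 : 0 < √(μ / lam) := Real.sqrt_pos.2 (by positivity)
  have hs1 : √(μ / lam) ≤ 1 := Real.sqrt_le_one.2 ((div_le_one hlam).2 hμlam)
  refine ⟨fun i => Xs i, hxs, fun h3 k => ?_, fun M ε hM hε hεM => ?_⟩
  -- `lam ≥ 3μ` gives `s² ≤ 1/3 ≤ 9/25`.
  · have hs35 : √(μ / lam) ≤ 3 / 5 := by
      rw [Real.sqrt_le_left (by norm_num), div_le_iff₀ hlam]
      linarith
    obtain ⟨hρ, hc, hcond⟩ := lyapunov_conditions_one_sub hs0 hs35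
    exact iapgd_gap_le hn hμ hμL hμlam hsm hf rfl le_rfl hρ hc hcond hxs x₀ k
  -- Only `μ ≤ lam` is available here, so the factor `1 - s/2` is used; it costs a constant in `K`.
  · obtain ⟨hρ, hc, hcond⟩ := lyapunov_conditions_one_sub_half hs0 hs1
    obtain ⟨K, hK, hKle⟩ := exists_iterations hs0 hs1 hε hεM
    have hinv : 1 / √(μ / lam) = √(lam / μ) := by
      rw [← inv_div lam μ, Real.sqrt_inv, one_div, inv_inv]
    rw [hinv] at hKle
    have hℓ : Real.log 2 ≤ Real.log (M / ε) :=
      Real.log_le_log two_pos ((le_div_iff₀ hε).2 (by linarith))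
    refine ⟨K, fun k hk => ?_, ?_, fun i => ?_⟩
    · refine (iapgd_gap_le hn hμ hμL hμlam hsm hf rfl (by linarith) hρ hc hcond hxs x₀ k).trans
        ((mul_le_mul_of_nonneg_left hM ?_).trans (hK k hk))
      exact mul_nonneg (by norm_num) (pow_nonneg (by linarith) k)
    · rw [iapgd_comms]
      have h1 : 0 ≤ √(lam / μ) * Real.log (M / ε) :=
        mul_nonneg (Real.sqrt_nonneg _) ((Real.log_nonneg one_le_two).trans hℓ)
      linarith
    · rw [iapgd_grads]
      exact sum_ceil_innerSteps_le hn hμ hμL hμlam hℓ hKle
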